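/- Let $n\ge 0$ be an integer and $\hbar>0$. For $\psi\in L^2(\mathbb R^n)$ let $$W\psi(x,p)=\Bigl(\tfrac1{2\pi\hbar}\Bigr)^n\int_{\mathbb R^n}e^{-\frac i\hbar p\cdot y}\,\psi(x+\tfrac12y)\,\overline{\psi(x-\tfrac12y)}\,dy$$ be its Wigner transform. Let $\ell$ be a Lagrangian subspace of $\mathbb R^{2n}=\mathbb R^n_x\times\mathbb R^n_p$ for the form $\omega((x,p),(x',p'))=p\cdot x'-x\cdot p'$, represented as $\ell=\{(x,p):Ax+Bp=0\}$ with real $n\times n$ matrices $A,B$ such that $A^TB$ is symmetric and $A^TA+B^TB=I$. The integral of a function $\rho$ on $\mathbb R^{2n}$ over the affine plane $\ell(z)=\ell+z$, $z=(x,p)$, is $$\int_{\ell(z)}\rho(s)\,ds=\int_{\mathbb R^n}\rho(-B^Tu+x,\;A^Tu+p)\,du ;$$ it exists if $u\mapsto\rho(-B^Tu+x,A^Tu+p)$ is Lebesgue integrable on $\mathbb R^n$. The metaplectic group $\mathrm{Mp}(n)$ is the group of unitary operators on $L^2(\mathbb R^n)$ generated by the following operators, and the covering homomorphism $\mathrm{Mp}(n)\to\mathrm{Sp}(n)$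 sends each to the symplectic matrix indicated: $\psi\mapsto e^{\frac i{2\hbar}Px\cdot x}\psi(x)$, with $P$ symmetric, to $\begin{pmatrix}I&0\\P&I\end{pmatrix}$; $\psi\mapsto i^m\sqrt{|\det L|}\,\psi(Lx)$, with $\det L\ne0$ and $m\pi$ an argument of $\det L$, to $\begin{pmatrix}L^{-1}&0\\0&L^T\end{pmatrix}$; and $\psi\mapsto(2\pi i\hbar)^{-n/2}\int_{\mathbb R^n}e^{-\frac i\hbar x\cdot x'}\psi(x')\,dx'$ (on $L^1\cap L^2$, with $\arg i=\pi/2$) to $\begin{pmatrix}0&I\\-I&0\end{pmatrix}$. Let $\psi\in L^1(\mathbb R^n)\cap L^2(\mathbb R^n)$ and let $\widehat U\in\mathrm{Mp}(n)$ cover the symplectic rotation $U=\begin{pmatrix}A&B\\-B&A\end{pmatrix}$. Then $$\int_{\ell(z)}W\psi(s)\,ds=|\widehat U\psi(Ax+Bp)|^2,\qquad z=(x,p),\tag{$*$}$$ in the following sense. (i) Let $f$ be any representative of $\widehat U\psi\in L^2(\mathbb R^n)$. For almost every $y\in\mathbb R^n$ and every $z=(x,p)$ with $Ax+Bp=y$: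 if the integral of $W\psi$ over $\ell(z)$ exists, then it equals $|f(y)|^2$; and, whether or not it exists, $$\lim_{\varepsilon\to0^+}\int_{\mathbb R^n}e^{-\varepsilon|u|^2}\,W\psi(-B^Tu+x,\;A^Tu+p)\,du=|f(y)|^2 .$$ (ii) Both assertions of (i) also hold for every $z=(x,p)$ such that $f$ is continuous at $y=Ax+Bp$. (iii) If $W\psi$ is integrable on $\mathbb R^{2n}$, then $\widehat U\psi$ has a continuous representative and, with this representative, for every $z\in\mathbb R^{2n}$ the integral in $(*)$ exists and $(*)$ holds. -/

import Mathlib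

open MeasureTheory Filter Topology

noncomputable section

namespace WignerRadon

/-- The space `ℝⁿ` (of positions `x`, of momenta `p`) with its Euclidean structure. -/
abbrev Conf (n : ℕ) : Type := EuclideanSpace ℝ (Fin n)

/-- The Hilbert space `L²(ℝⁿ)` of complex functions, for Lebesgue measure. -/
abbrev L2 (n : ℕ) : Type := Lp ℂ 2 (volume : Measure (Conf n))

/-- The action of an `n × n` real matrix on `ℝⁿ`. -/
def act {n : ℕ} (A : Matrix (Fin n) (Fin n) ℝ) (x : Conf n) : Conf n :=
  Matrix.toEuclideanLin A x

/-- The standard symplectic form `ω(z, z') = Jz · z' = p · x' - x · p'`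
on phase space, where `z = (x, p)` and `z' = (x', p')`. -/
def omega {n : ℕ} (z z' : Conf n × Conf n) : ℝ :=
  inner ℝ z.2 z'.1 - inner ℝ z.1 z'.2

/-- Lagrangian subspaces: the `n`-dimensional subspaces on which `ω` vanishes identically. -/
def IsLagrangian {n : ℕ} (l : Submodule ℝ (Conf n × Conf n)) : Prop :=
  Module.finrank ℝ l = n ∧ ∀ z ∈ l, ∀ z' ∈ l, omega z z' = 0

/-- `l` is represented by the system of equations `A x + B p = 0`, with `Aᵀ B` symmetric and
`Aᵀ A + Bᵀ B = I`. -/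
structure RepresentedBy {n : ℕ} (l : Submodule ℝ (Conf n × Conf n))
    (A B : Matrix (Fin n) (Fin n) ℝ) : Prop where
  mem_iff : ∀ x p : Conf n, (x, p) ∈ l ↔ act A x + act B p = 0
  symm : (A.transpose * B).IsSymm
  normalized : A.transpose * A + B.transpose * B = 1

/-- The Wigner transform
`Wψ(x, p) = (2πħ)⁻ⁿ ∫ exp(-(i/ħ) p·y) ψ(x + y/2) conj(ψ(x - y/2)) dy`.
For `ψ` in `L²` the integrand is integrable for every `(x, p)`. -/
def wigner {n : ℕ} (hbar : ℝ) (ψ : Conf n → ℂ) (x p : Conf n) : ℂ :=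
  ((1 / (2 * Real.pi * hbar) : ℝ) : ℂ) ^ n *
    ∫ y : Conf n, Complex.exp (-(Complex.I / (hbar : ℂ)) * ((inner ℝ p y : ℝ) : ℂ)) *
      ψ (x + (1 / 2 : ℝ) • y) * starRingEnd ℂ (ψ (x - (1 / 2 : ℝ) • y))

/-! ### Integrals along the affine plane through `(x, p)` parallel to `A x + B p = 0` -/

/-- The restriction of `ρ` to the affine plane, in the parametrization
`u ↦ (-Bᵀ u + x, Aᵀ u + p)`. -/
def onPlane {n : ℕ} (A B : Matrix (Fin n) (Fin n) ℝ) (ρ : Conf n → Conf n → ℂ)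
    (x p u : Conf n) : ℂ :=
  ρ (-(act B.transpose u) + x) (act A.transpose u + p)

/-- The integral of `ρ` along the affine plane exists (as a Lebesgue integral). -/
def PlaneIntegrable {n : ℕ} (A B : Matrix (Fin n) (Fin n) ℝ) (ρ : Conf n → Conf n → ℂ)
    (x p : Conf n) : Prop :=
  Integrable (onPlane A B ρ x p) volume

/-- The integral `∫ ρ(-Bᵀ u + x, Aᵀ u + p) du` of `ρ` along the affine plane. -/
def planeIntegral {n : ℕ} (A B : Matrix (Fin n) (Fin n) ℝ) (ρ : Conf n → Conf n → ℂ)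
    (x p : Conf n) : ℂ :=
  ∫ u : Conf n, onPlane A B ρ x p u

/-- The same integral with the Gaussian convergence factor `exp(-ε |u|²)`. -/
def regPlaneIntegral {n : ℕ} (A B : Matrix (Fin n) (Fin n) ℝ) (ρ : Conf n → Conf n → ℂ)
    (x p : Conf n) (ε : ℝ) : ℂ :=
  ∫ u : Conf n, ((Real.exp (-ε * ‖u‖ ^ 2) : ℝ) : ℂ) * onPlane A B ρ x p u

/-! ### The metaplectic group -/

/-- `T` is the operator `ψ ↦ exp((i/2ħ) P x·x) ψ(x)`. -/
def IsChirp {n : ℕ} (hbar : ℝ) (P : Matrix (Fin n) (Fin n) ℝ) (T : L2 n ≃ₗᵢ[ℂ] L2 n) : Prop :=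
  ∀ ψ : L2 n, T ψ =ᵐ[volume] fun x : Conf n =>
    Complex.exp (Complex.I / (2 * (hbar : ℂ)) * ((inner ℝ (act P x) x : ℝ) : ℂ)) * ψ x

/-- `T` is the operator `ψ ↦ i^m √|det L| ψ(L x)`. -/
def IsDilation {n : ℕ} (L : Matrix (Fin n) (Fin n) ℝ) (m : ℤ) (T : L2 n ≃ₗᵢ[ℂ] L2 n) : Prop :=
  ∀ ψ : L2 n, T ψ =ᵐ[volume] fun x : Conf n =>
    Complex.I ^ m * ((Real.sqrt |L.det| : ℝ) : ℂ) * ψ (act L x)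

/-- `mπ` is a choice of the argument of the nonzero real number `d`. -/
def IsArgChoice (d : ℝ) (m : ℤ) : Prop := (0 < d ∧ Even m) ∨ (d < 0 ∧ Odd m)

/-- `T` is the unitary operator given on `L¹ ∩ L²` by
`ψ ↦ (2πiħ)^(-n/2) ∫ exp(-(i/ħ) x·x') ψ(x') dx'`; by density this determines `T`. -/
def IsFourier {n : ℕ} (hbar : ℝ) (T : L2 n ≃ₗᵢ[ℂ] L2 n) : Prop :=
  ∀ (ψ : Conf n → ℂ) (_ : MemLp ψ 1 volume) (h2 : MemLp ψ 2 volume),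
    T (h2.toLp ψ) =ᵐ[volume] fun x : Conf n =>
      (1 / (2 * (Real.pi : ℂ) * Complex.I * (hbar : ℂ))) ^ ((n : ℂ) / 2) *
        ∫ y : Conf n, Complex.exp (-(Complex.I / (hbar : ℂ)) * ((inner ℝ x y : ℝ) : ℂ)) * ψ y

/-- The generators of the metaplectic group, each with the symplectic matrix that it covers:
* `ψ ↦ exp((i/2ħ) P x·x) ψ(x)` with `[[I, 0], [P, I]]`, for `P` symmetric;
* `ψ ↦ i^m √|det L| ψ(L x)` with `[[L⁻¹, 0], [0, Lᵀ]]`, for `det L ≠ 0` and `arg det L = mπ`;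
* the `ħ`-Fourier transform with `[[0, I], [-I, 0]]`. -/
def metaplecticGenerators (n : ℕ) (hbar : ℝ) :
    Set ((L2 n ≃ₗᵢ[ℂ] L2 n) × Matrix.symplecticGroup (Fin n) ℝ) :=
  {g | (∃ P : Matrix (Fin n) (Fin n) ℝ, P.IsSymm ∧ IsChirp hbar P g.1 ∧
          (g.2 : Matrix (Fin n ⊕ Fin n) (Fin n ⊕ Fin n) ℝ) = Matrix.fromBlocks 1 0 P 1) ∨
       (∃ (L : Matrix (Fin n) (Fin n) ℝ) (m : ℤ), IsArgChoice L.det m ∧ IsDilation L m g.1 ∧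
          (g.2 : Matrix (Fin n ⊕ Fin n) (Fin n ⊕ Fin n) ℝ) =
            Matrix.fromBlocks L⁻¹ 0 0 L.transpose) ∨
       (IsFourier hbar g.1 ∧
          (g.2 : Matrix (Fin n ⊕ Fin n) (Fin n ⊕ Fin n) ℝ) = Matrix.fromBlocks 0 1 (-1) 0)}

/-- The graph of the covering homomorphism `Mp(n) → Sp(n)`: the group generated by the pairs
(generator of `Mp(n)`, its projection). -/
def metaplecticGraph (n : ℕ) (hbar : ℝ) :
    Subgroup ((L2 n ≃ₗᵢ[ℂ] L2 n) × Matrix.symplecticGroup (Fin n) ℝ) :=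
  Subgroup.closure (metaplecticGenerators n hbar)

/-- The metaplectic group `Mp(n)`, a group of unitary operators on `L²(ℝⁿ)`. -/
def metaplecticGroup (n : ℕ) (hbar : ℝ) : Subgroup (L2 n ≃ₗᵢ[ℂ] L2 n) :=
  (metaplecticGraph n hbar).map (MonoidHom.fst _ _)

/-- The metaplectic operator `T` covers the symplectic matrix `S`. -/
def Covers {n : ℕ} (hbar : ℝ) (T : metaplecticGroup n hbar)
    (S : Matrix (Fin n ⊕ Fin n) (Fin n ⊕ Fin n) ℝ) : Prop :=
  ∃ hS : S ∈ Matrix.symplecticGroup (Fin n) ℝ,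
    ((T : L2 n ≃ₗᵢ[ℂ] L2 n), (⟨S, hS⟩ : Matrix.symplecticGroup (Fin n) ℝ)) ∈
      metaplecticGraph n hbar

end WignerRadon

end

noncomputable section

namespace WignerRadon

open scoped ENNReal NNReal SchwartzMap FourierTransform
open Metric (ball closedBall)

/-- The nonnegative function `h` has vanishing mean values over the balls shrinking to `y`. -/
def MeanVanishesAt {n : ℕ} (h : Conf n → ℝ≥0∞) (y : Conf n) : Prop :=
  ∀ δ : ℝ≥0, 0 < δ → ∀ᶠ r in 𝓝[>] (0 : ℝ),
    ∫⁻ t in ball y r, h t ≤ δ * volume (ball y r)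

/-- The normalized Gaussian `(k/π)^(n/2) exp(-k |t|²)`. -/
def gaussKer {n : ℕ} (k : ℝ) (t : Conf n) : ℝ :=
  (k / Real.pi) ^ ((n : ℝ) / 2) * Real.exp (-k * ‖t‖ ^ 2)

lemma gaussKer_pos {n : ℕ} {k : ℝ} (hk : 0 < k) (t : Conf n) : 0 < gaussKer k t := by
  unfold gaussKer
  have := Real.pi_pos
  positivity

lemma continuous_gaussKer {n : ℕ} (k : ℝ) : Continuous (gaussKer k : Conf n → ℝ) := by
  unfold gaussKer
  fun_prop

lemma integrable_exp_neg_sq {n : ℕ} {k : ℝ} (hk : 0 < k) :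
    Integrable (fun t : Conf n => Real.exp (-k * ‖t‖ ^ 2)) := by
  have h := GaussianFourier.integrable_cexp_neg_mul_sq_norm_add (V := Conf n)
    (b := (k : ℂ)) (by simpa using hk) 0 0
  refine h.norm.congr (Eventually.of_forall fun t => ?_)
  simp only [Complex.norm_exp]
  norm_cast
  simp

lemma integrable_gaussKer {n : ℕ} {k : ℝ} (hk : 0 < k) :
    Integrable (gaussKer k : Conf n → ℝ) :=
  (integrable_exp_neg_sq hk).const_mul _

lemma integral_gaussKer {n : ℕ} {k : ℝ} (hk : 0 < k) :
    ∫ t : Conf n, gaussKer k t = 1 := by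
  unfold gaussKer
  rw [integral_const_mul, GaussianFourier.integral_rexp_neg_mul_sq_norm hk]
  have := Real.pi_pos
  rw [finrank_euclideanSpace_fin, ← Real.mul_rpow (by positivity) (by positivity)]
  rw [div_mul_div_cancel₀ (by positivity), div_self hk.ne', Real.one_rpow]

lemma lintegral_gaussKer {n : ℕ} {k : ℝ} (hk : 0 < k) :
    ∫⁻ t : Conf n, ENNReal.ofReal (gaussKer k t) = 1 := by
  rw [← ofReal_integral_eq_lintegral_ofReal (integrable_gaussKer hk)
    (Eventually.of_forall fun t => (gaussKer_pos hk t).le), integral_gaussKer hk,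
    ENNReal.ofReal_one]

lemma setOf_lt_gaussKer {n : ℕ} {k : ℝ} (hk : 0 < k) {s : ℝ} (hs : 0 < s) :
    ∃ R : ℝ, {t : Conf n | s < gaussKer k t} = ball 0 R := by
  set c : ℝ := (k / Real.pi) ^ ((n : ℝ) / 2) with hc
  have hc0 : 0 < c := by
    have := Real.pi_pos
    positivity
  refine ⟨Real.sqrt (-Real.log (s / c) / k), ?_⟩
  ext t
  simp only [Set.mem_ofPred_eq, mem_ball_zero_iff]
  rw [Real.lt_sqrt (norm_nonneg _), lt_div_iff₀ hk, lt_neg]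
  unfold gaussKer
  rw [← hc, ← div_lt_iff₀' hc0, ← Real.log_lt_iff_lt_exp (by positivity)]
  ring_nf

lemma lintegral_gaussKer_mul_le {n : ℕ} {k : ℝ} (hk : 0 < k) {h : Conf n → ℝ≥0∞}
    (hm : AEMeasurable h) {r₀ : ℝ} {δ : ℝ≥0}
    (hδ : ∀ r, 0 < r → r ≤ r₀ → ∫⁻ t in ball 0 r, h t ≤ δ * volume (ball (0 : Conf n) r)) :
    ∫⁻ t in ball 0 r₀, ENNReal.ofReal (gaussKer k t) * h t ≤ δ := by
  set ν : Measure (Conf n) := (volume.restrict (ball 0 r₀)).withDensity h with hν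
  have e1 : ∫⁻ t in ball 0 r₀, ENNReal.ofReal (gaussKer k t) * h t
      = ∫⁻ t, ENNReal.ofReal (gaussKer k t) ∂ν := by
    rw [hν, lintegral_withDensity_eq_lintegral_mul₀ hm.restrict
      (continuous_gaussKer k).measurable.ennreal_ofReal.aemeasurable]
    simp only [Pi.mul_apply, mul_comm]
  rw [e1, lintegral_eq_lintegral_meas_lt ν (Eventually.of_forall fun t => (gaussKer_pos hk t).le)
    (continuous_gaussKer k).measurable.aemeasurable]
  have e2 : ∀ s ∈ Set.Ioi (0 : ℝ), ν {t | s < gaussKer k t}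
      ≤ δ * volume {t : Conf n | s < gaussKer k t} := by
    intro s hs
    obtain ⟨R, hR⟩ := setOf_lt_gaussKer (n := n) hk (Set.mem_Ioi.1 hs)
    rw [hR, hν, withDensity_apply _ Metric.isOpen_ball.measurableSet,
      Measure.restrict_restrict Metric.isOpen_ball.measurableSet]
    have hsub : ball (0 : Conf n) R ∩ ball 0 r₀ = ball 0 (min R r₀) := by
      ext t; simp
    rw [hsub]
    rcases le_or_gt (min R r₀) 0 with h0 | h0
    · rw [Metric.ball_eq_empty.2 h0]; simp
    · exact (hδ _ h0 (min_le_right _ _)).trans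
        (by gcongr; exact min_le_left _ _)
  calc ∫⁻ s in Set.Ioi (0 : ℝ), ν {t | s < gaussKer k t}
      ≤ ∫⁻ s in Set.Ioi (0 : ℝ), δ * volume {t : Conf n | s < gaussKer k t} :=
        setLIntegral_mono' measurableSet_Ioi e2
    _ = δ * ∫⁻ s in Set.Ioi (0 : ℝ), volume {t : Conf n | s < gaussKer k t} :=
        lintegral_const_mul' _ _ ENNReal.coe_ne_top
    _ = δ := by
        rw [← lintegral_eq_lintegral_meas_lt volume
          (Eventually.of_forall fun t => (gaussKer_pos hk t).le)
          (continuous_gaussKer k).measurable.aemeasurable, lintegral_gaussKer hk, mul_one]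

lemma gaussKer_le_of_le_norm {n : ℕ} {k : ℝ} (hk : 1 ≤ k) {r₀ : ℝ} (hr : 0 ≤ r₀) {t : Conf n}
    (ht : r₀ ≤ ‖t‖) :
    gaussKer k t ≤ (k / Real.pi) ^ ((n : ℝ) / 2) * Real.exp (-(k - 1) * r₀ ^ 2)
      * Real.exp (-‖t‖ ^ 2) := by
  unfold gaussKer
  rw [mul_assoc, ← Real.exp_add]
  have := Real.pi_pos
  gcongr
  have : r₀ ^ 2 ≤ ‖t‖ ^ 2 := by gcongr
  nlinarith

lemma tendsto_gauss_tail (n : ℕ) {r₀ : ℝ} (hr : 0 < r₀) :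
    Tendsto (fun k : ℝ => (k / Real.pi) ^ ((n : ℝ) / 2) * Real.exp (-(k - 1) * r₀ ^ 2))
      atTop (𝓝 0) := by
  have h := (tendsto_rpow_mul_exp_neg_mul_atTop_nhds_zero ((n : ℝ) / 2) (r₀ ^ 2)
    (by positivity)).const_mul (Real.exp (r₀ ^ 2) / Real.pi ^ ((n : ℝ) / 2))
  rw [mul_zero] at h
  refine h.congr' ?_
  filter_upwards [eventually_ge_atTop 0] with k hk
  rw [Real.div_rpow hk Real.pi_pos.le]
  have : Real.exp (-(k - 1) * r₀ ^ 2) = Real.exp (r₀ ^ 2) * Real.exp (-r₀ ^ 2 * k) := by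
    rw [← Real.exp_add]; ring_nf
  rw [this]; ring

/-- Gaussian means of a function whose mean values over balls vanish. -/
lemma MeanVanishesAt.tendsto_gauss {n : ℕ} {h : Conf n → ℝ≥0∞} (hm : AEMeasurable h)
    (hv : MeanVanishesAt h 0)
    (hfin : ∫⁻ t, ENNReal.ofReal (Real.exp (-‖t‖ ^ 2)) * h t ≠ ∞) :
    Tendsto (fun k : ℝ => ∫⁻ t, ENNReal.ofReal (gaussKer k t) * h t) atTop (𝓝 0) := by
  rw [ENNReal.tendsto_nhds_zero]
  intro ε hε
  obtain ⟨δ, hδ, hδε⟩ : ∃ δ : ℝ≥0, 0 < δ ∧ (δ : ℝ≥0∞) + δ ≤ ε := by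
    obtain ⟨δ, h0, h1⟩ := ENNReal.lt_iff_exists_nnreal_btwn.1 (ENNReal.half_pos hε.ne')
    refine ⟨δ, by exact_mod_cast h0, ?_⟩
    calc (δ : ℝ≥0∞) + δ ≤ ε / 2 + ε / 2 := by gcongr
      _ = ε := ENNReal.add_halves ε
  obtain ⟨r₁, hr₁, hr⟩ := mem_nhdsGT_iff_exists_Ioc_subset.1 (hv δ hδ)
  have hr₁ : 0 < r₁ := hr₁
  have htail : Tendsto (fun k : ℝ => ENNReal.ofReal
      ((k / Real.pi) ^ ((n : ℝ) / 2) * Real.exp (-(k - 1) * r₁ ^ 2)) *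
      ∫⁻ t : Conf n, ENNReal.ofReal (Real.exp (-‖t‖ ^ 2)) * h t) atTop (𝓝 0) := by
    have := ENNReal.Tendsto.mul_const (b := ∫⁻ t, ENNReal.ofReal (Real.exp (-‖t‖ ^ 2)) * h t)
      (ENNReal.tendsto_ofReal (tendsto_gauss_tail n hr₁)) (Or.inr hfin)
    simpa using this
  filter_upwards [eventually_ge_atTop 1,
    (ENNReal.tendsto_nhds_zero.1 htail) δ (by exact_mod_cast hδ)] with k hk hk2
  have hk0 : 0 < k := by linarith
  rw [← lintegral_add_compl _ (Metric.isOpen_ball (x := (0 : Conf n)) (ε := r₁)).measurableSet]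
  refine le_trans (add_le_add (lintegral_gaussKer_mul_le hk0 hm
    fun r h0 h1 => hr ⟨h0, h1⟩) (le_trans ?_ hk2)) hδε
  rw [← lintegral_const_mul' _ _ ENNReal.ofReal_ne_top]
  refine le_trans (setLIntegral_mono' Metric.isOpen_ball.measurableSet.compl
    (g := fun t => ENNReal.ofReal
      ((k / Real.pi) ^ ((n : ℝ) / 2) * Real.exp (-(k - 1) * r₁ ^ 2)) *
      (ENNReal.ofReal (Real.exp (-‖t‖ ^ 2)) * h t)) fun t ht => ?_)
    (setLIntegral_le_lintegral _ _)
  rw [← mul_assoc, ← ENNReal.ofReal_mul (by have := Real.pi_pos; positivity)]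
  gcongr
  exact gaussKer_le_of_le_norm hk hr₁.le (by simpa using ht)

/-- Gaussian means of an integrable function converge at its Lebesgue points. -/
lemma tendsto_integral_gaussKer {n : ℕ} {F : Conf n → ℂ} (hF : Integrable F) {c : ℂ}
    (hv : MeanVanishesAt (fun t => ‖F t - c‖ₑ) 0) :
    Tendsto (fun k : ℝ => ∫ t, (gaussKer k t : ℂ) * F t) atTop (𝓝 c) := by
  have hmeas : AEStronglyMeasurable (fun t => F t - c) :=
    hF.aestronglyMeasurable.sub aestronglyMeasurable_const
  have hexp : Integrable (fun t : Conf n => Real.exp (-‖t‖ ^ 2)) := by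
    simpa using integrable_exp_neg_sq (n := n) one_pos
  have hfin : ∫⁻ t, ENNReal.ofReal (Real.exp (-‖t‖ ^ 2)) * ‖F t - c‖ₑ ≠ ∞ := by
    have hb : ∫⁻ t, ‖F t‖ₑ + ENNReal.ofReal (Real.exp (-‖t‖ ^ 2)) * ‖c‖ₑ < ∞ := by
      rw [lintegral_add_left' hF.aestronglyMeasurable.enorm, lintegral_mul_const' _ _ (by simp)]
      refine ENNReal.add_lt_top.2 ⟨hF.2, ENNReal.mul_lt_top ?_ (by simp)⟩
      exact hexp.lintegral_lt_top
    refine (lt_of_le_of_lt (lintegral_mono fun t => ?_) hb).ne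
    have h1 : ENNReal.ofReal (Real.exp (-‖t‖ ^ 2)) ≤ 1 := by
      rw [ENNReal.ofReal_le_one, Real.exp_le_one_iff]
      nlinarith [sq_nonneg ‖t‖]
    calc ENNReal.ofReal (Real.exp (-‖t‖ ^ 2)) * ‖F t - c‖ₑ
        ≤ ENNReal.ofReal (Real.exp (-‖t‖ ^ 2)) * (‖F t‖ₑ + ‖c‖ₑ) := by gcongr; exact enorm_sub_le
      _ = ENNReal.ofReal (Real.exp (-‖t‖ ^ 2)) * ‖F t‖ₑ
          + ENNReal.ofReal (Real.exp (-‖t‖ ^ 2)) * ‖c‖ₑ := mul_add _ _ _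
      _ ≤ 1 * ‖F t‖ₑ + ENNReal.ofReal (Real.exp (-‖t‖ ^ 2)) * ‖c‖ₑ := by gcongr
      _ = _ := by rw [one_mul]
  have key := hv.tendsto_gauss hmeas.enorm hfin
  rw [tendsto_iff_edist_tendsto_0]
  refine tendsto_of_tendsto_of_tendsto_of_le_of_le' tendsto_const_nhds key
    (Eventually.of_forall fun _ => zero_le) ?_
  filter_upwards [eventually_gt_atTop 0] with k hk
  have hG : Integrable (fun t : Conf n => (gaussKer k t : ℂ)) := (integrable_gaussKer hk).ofReal
  have hbd : ∃ C, ∀ t : Conf n, ‖(gaussKer k t : ℂ)‖ ≤ C := by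
    refine ⟨(k / Real.pi) ^ ((n : ℝ) / 2), fun t => ?_⟩
    rw [Complex.norm_real, Real.norm_of_nonneg (gaussKer_pos hk t).le]
    unfold gaussKer
    have := Real.pi_pos
    refine mul_le_of_le_one_right (by positivity) ?_
    rw [Real.exp_le_one_iff]
    nlinarith [sq_nonneg ‖t‖]
  obtain ⟨C, hC⟩ := hbd
  have hGF : Integrable (fun t => (gaussKer k t : ℂ) * F t) :=
    hF.bdd_mul (c := C) hG.aestronglyMeasurable (Eventually.of_forall hC)
  have hc : c = ∫ t : Conf n, (gaussKer k t : ℂ) * c := by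
    rw [integral_mul_const, integral_complex_ofReal, integral_gaussKer hk]; simp
  rw [edist_eq_enorm_sub]
  nth_rewrite 1 [hc]
  rw [← integral_sub hGF (hG.mul_const c)]
  refine (enorm_integral_le_lintegral_enorm _).trans (lintegral_mono fun t => ?_)
  show ‖(gaussKer k t : ℂ) * F t - gaussKer k t * c‖ₑ ≤ _
  rw [← mul_sub, enorm_mul, ← Real.enorm_of_nonneg (gaussKer_pos hk t).le]
  gcongr
  rw [← ofReal_norm, Complex.norm_real, ofReal_norm]

lemma MeanVanishesAt.mono {n : ℕ} {h h' : Conf n → ℝ≥0∞} {y : Conf n}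
    (hv : MeanVanishesAt h y) (hle : ∀ t, h' t ≤ h t) : MeanVanishesAt h' y := fun δ hδ =>
  (hv δ hδ).mono fun _ hr => (lintegral_mono hle).trans hr

lemma MeanVanishesAt.add {n : ℕ} {h h' : Conf n → ℝ≥0∞} {y : Conf n}
    (hm : AEMeasurable h) (hv : MeanVanishesAt h y) (hv' : MeanVanishesAt h' y) :
    MeanVanishesAt (fun t => h t + h' t) y := fun δ hδ => by
  filter_upwards [hv (δ / 2) (half_pos hδ), hv' (δ / 2) (half_pos hδ)] with r h1 h2
  rw [lintegral_add_left' hm.restrict]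
  refine (add_le_add h1 h2).trans_eq ?_
  rw [← add_mul, ← ENNReal.coe_add, add_halves]

lemma MeanVanishesAt.const_mul {n : ℕ} {h : Conf n → ℝ≥0∞} {y : Conf n}
    (hv : MeanVanishesAt h y) (C : ℝ≥0) :
    MeanVanishesAt (fun t => C * h t) y := fun δ hδ => by
  filter_upwards [hv (δ / (C + 1)) (by positivity)] with r h1
  rw [lintegral_const_mul' _ _ ENNReal.coe_ne_top]
  calc (C : ℝ≥0∞) * ∫⁻ t in ball y r, h t
      ≤ C * (((δ / (C + 1) : ℝ≥0) : ℝ≥0∞) * volume (ball y r)) := by gcongr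
    _ = ((C * (δ / (C + 1)) : ℝ≥0) : ℝ≥0∞) * volume (ball y r) := by
        rw [← mul_assoc, ENNReal.coe_mul]
    _ ≤ δ * volume (ball y r) := by
        gcongr
        rw [← mul_div_assoc, div_le_iff₀ (by positivity), mul_comm]
        gcongr
        exact le_self_add

lemma meanVanishesAt_of_tendsto {n : ℕ} {h : Conf n → ℝ≥0∞} {y : Conf n}
    (ht : Tendsto h (𝓝 y) (𝓝 0)) : MeanVanishesAt h y := fun δ hδ => by
  have h1 := (ENNReal.tendsto_nhds_zero.1 ht) δ (by exact_mod_cast hδ)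
  obtain ⟨r₀, hr₀, hr⟩ := Metric.eventually_nhds_iff_ball.1 h1
  filter_upwards [Ioo_mem_nhdsGT hr₀] with r hr'
  calc ∫⁻ t in ball y r, h t ≤ ∫⁻ t in ball y r, δ :=
        setLIntegral_mono' Metric.isOpen_ball.measurableSet fun t ht =>
          hr t (Metric.ball_subset_ball hr'.2.le ht)
    _ = δ * volume (ball y r) := by rw [setLIntegral_const]

lemma map_affine {n : ℕ} (y : Conf n) {a : ℝ} (ha : a ≠ 0) :
    Measure.map (fun t : Conf n => y + a • t) volume
      = ENNReal.ofReal |(a ^ n)⁻¹| • (volume : Measure (Conf n)) := by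
  have h1 : (fun t : Conf n => y + a • t) = (fun t => y + t) ∘ (fun t => a • t) := rfl
  rw [h1, ← Measure.map_map (by fun_prop) (by fun_prop), Measure.map_addHaar_smul _ ha,
    Measure.map_smul, map_add_left_eq_self, finrank_euclideanSpace_fin]

lemma measurableEmbedding_affine {n : ℕ} (y : Conf n) {a : ℝ} (ha : a ≠ 0) :
    MeasurableEmbedding (fun t : Conf n => y + a • t) :=
  ((Homeomorph.smulOfNeZero a ha).trans (Homeomorph.addLeft y)).measurableEmbedding

/-- Vanishing means are preserved by the affine maps `t ↦ y + a t`. -/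
lemma MeanVanishesAt.comp_affine {n : ℕ} {h : Conf n → ℝ≥0∞} {y : Conf n}
    (hv : MeanVanishesAt h y) {a : ℝ} (ha : a ≠ 0) :
    MeanVanishesAt (fun t => h (y + a • t)) 0 := fun δ hδ => by
  have ha' : 0 < |a| := abs_pos.2 ha
  have hlim : Tendsto (fun r : ℝ => |a| * r) (𝓝[>] 0) (𝓝[>] 0) := by
    refine tendsto_nhdsWithin_iff.2 ⟨?_, ?_⟩
    · have : Tendsto (fun r : ℝ => |a| * r) (𝓝 0) (𝓝 (|a| * 0)) := by
        exact (continuous_const.mul continuous_id).tendsto 0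
      rw [mul_zero] at this
      exact this.mono_left nhdsWithin_le_nhds
    · filter_upwards [self_mem_nhdsWithin] with r hr
      exact mul_pos ha' hr
  filter_upwards [hlim.eventually (hv δ hδ)] with r hr
  set c : ℝ≥0∞ := ENNReal.ofReal |(a ^ n)⁻¹| with hc
  have hmap := map_affine y ha
  have hemb := measurableEmbedding_affine y ha
  have hpre : (fun t : Conf n => y + a • t) ⁻¹' ball y (|a| * r) = ball 0 r := by
    ext t
    simp [norm_smul, ha']
  have e1 : ∫⁻ t in ball (0 : Conf n) r, h (y + a • t)
      = c * ∫⁻ t in ball y (|a| * r), h t := by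
    rw [← hpre, ← hemb.lintegral_map, ← hemb.restrict_map, hmap, Measure.restrict_smul,
      lintegral_smul_measure, smul_eq_mul]
  have e2 : volume (ball (0 : Conf n) r) = c * volume (ball y (|a| * r)) := by
    rw [← hpre, ← hemb.map_apply, hmap, Measure.smul_apply, smul_eq_mul]
  rw [e1, e2, mul_left_comm]
  gcongr

lemma tendsto_closedBall_average_meanVanishesAt {n : ℕ} {g : Conf n → ℝ} {y : Conf n}
    (hg : LocallyIntegrable g) (h0 : ∀ t, 0 ≤ g t)
    (h : Tendsto (fun r => ⨍ t in closedBall y r, g t) (𝓝[>] 0) (𝓝 0)) :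
    MeanVanishesAt (fun t => ENNReal.ofReal (g t)) y := fun δ hδ => by
  have hδ' : (0 : ℝ) < δ := hδ
  filter_upwards [h.eventually (Iic_mem_nhds hδ'), self_mem_nhdsWithin] with r hr hr0
  have hr0 : 0 < r := hr0
  have hr : ⨍ t in closedBall y r, g t ≤ δ := hr
  have hi : IntegrableOn g (closedBall y r) :=
    hg.integrableOn_isCompact (isCompact_closedBall y r)
  have hvol : volume (closedBall y r) = volume (ball y r) := by
    rw [Measure.addHaar_closedBall _ _ hr0.le, Measure.addHaar_ball_of_pos _ _ hr0]
  have hpos : 0 < volume.real (closedBall y r) := by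
    rw [Measure.real, hvol]
    exact ENNReal.toReal_pos (Metric.measure_ball_pos _ _ hr0).ne' measure_ball_lt_top.ne
  rw [setAverage_eq, smul_eq_mul, inv_mul_le_iff₀ hpos, mul_comm] at hr
  calc ∫⁻ t in ball y r, ENNReal.ofReal (g t)
      ≤ ∫⁻ t in closedBall y r, ENNReal.ofReal (g t) :=
        lintegral_mono_set Metric.ball_subset_closedBall
    _ = ENNReal.ofReal (∫ t in closedBall y r, g t) :=
        (ofReal_integral_eq_lintegral_ofReal hi (Eventually.of_forall h0)).symm
    _ ≤ ENNReal.ofReal (δ * volume.real (closedBall y r)) := ENNReal.ofReal_le_ofReal hr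
    _ = δ * volume (ball y r) := by
        rw [ENNReal.ofReal_mul hδ'.le, ENNReal.ofReal_coe_nnreal, Measure.real,
          ENNReal.ofReal_toReal (by rw [hvol]; exact measure_ball_lt_top.ne), hvol]

/-- Almost every point is a Lebesgue point, in `L¹` and `L²` mean, of a function in `L²`. -/
lemma ae_meanVanishesAt {n : ℕ} {f : Conf n → ℂ} (hf : MemLp f 2 volume) :
    ∀ᵐ y, MeanVanishesAt (fun t => ENNReal.ofReal (‖f t - f y‖ + ‖f t - f y‖ ^ 2)) y := by
  have hl1 : LocallyIntegrable f := hf.locallyIntegrable (by norm_num)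
  have hi2 : Integrable (fun t => ‖f t‖ ^ 2) := by
    have := hf.integrable_norm_pow (by norm_num)
    simpa using this
  have hl2 : LocallyIntegrable (fun t => ‖f t‖ ^ 2) := hi2.locallyIntegrable
  filter_upwards [IsUnifLocDoublingMeasure.ae_tendsto_average_norm_sub volume hl1 1,
    IsUnifLocDoublingMeasure.ae_tendsto_average volume hl1 1,
    IsUnifLocDoublingMeasure.ae_tendsto_average volume hl2 1] with y h1 h2 h3
  have hmem : ∀ᶠ r in 𝓝[>] (0 : ℝ), y ∈ closedBall y (1 * r) := by
    filter_upwards [self_mem_nhdsWithin] with r hr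
    rw [one_mul]
    exact Metric.mem_closedBall_self (le_of_lt hr)
  have h1 := h1 (fun _ => y) (fun r => r) tendsto_id hmem
  have h2 := h2 (fun _ => y) (fun r => r) tendsto_id hmem
  have h3 := h3 (fun _ => y) (fun r => r) tendsto_id hmem
  have hexp : ∀ t, ‖f t - f y‖ ^ 2
      = ‖f t‖ ^ 2 - 2 * (f t * starRingEnd ℂ (f y)).re + ‖f y‖ ^ 2 := fun t => by
    rw [← Complex.normSq_eq_norm_sq, Complex.normSq_sub, Complex.normSq_eq_norm_sq,
      Complex.normSq_eq_norm_sq]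
    ring
  have hloc : LocallyIntegrable (fun t => ‖f t - f y‖ + ‖f t - f y‖ ^ 2) := by
    have a1 : LocallyIntegrable (fun t => f t - f y) := hl1.sub (locallyIntegrable_const _)
    have a2 : LocallyIntegrable (fun t => ‖f t - f y‖) := fun x => by
      obtain ⟨s, hs, hi⟩ := a1 x
      exact ⟨s, hs, hi.norm⟩
    have a3 : LocallyIntegrable (fun t => 2 * (f t * starRingEnd ℂ (f y)).re) := fun x => by
      obtain ⟨s, hs, hi⟩ := hl1 x
      exact ⟨s, hs, (hi.mul_const (starRingEnd ℂ (f y))).re.const_mul 2⟩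
    have a4 : LocallyIntegrable (fun t => ‖f t - f y‖ ^ 2) := by
      simp_rw [hexp]
      exact (hl2.sub a3).add (locallyIntegrable_const _)
    exact a2.add a4
  refine tendsto_closedBall_average_meanVanishesAt hloc (fun t => by positivity) ?_
  have hlim := h1.add ((h3.sub ((Complex.continuous_re.tendsto _).comp
    (h2.mul_const (starRingEnd ℂ (f y)))|>.const_mul 2)).add_const (‖f y‖ ^ 2))
  have hz : 0 + (‖f y‖ ^ 2 - 2 * (f y * starRingEnd ℂ (f y)).re + ‖f y‖ ^ 2) = 0 := by
    rw [Complex.mul_conj, Complex.ofReal_re, Complex.normSq_eq_norm_sq]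
    ring
  rw [hz] at hlim
  refine hlim.congr' ?_
  filter_upwards [self_mem_nhdsWithin] with r hr
  have hr : 0 < r := hr
  have hfin : volume (closedBall y r) ≠ ∞ := measure_closedBall_lt_top.ne
  have hpos : volume.real (closedBall y r) ≠ 0 :=
    (ENNReal.toReal_pos (Metric.measure_closedBall_pos _ _ hr).ne' hfin).ne'
  have i1 : IntegrableOn f (closedBall y r) :=
    hl1.integrableOn_isCompact (isCompact_closedBall y r)
  have ic : ∀ c : ℝ, IntegrableOn (fun _ : Conf n => c) (closedBall y r) := fun c =>
    (locallyIntegrable_const c).integrableOn_isCompact (isCompact_closedBall y r)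
  have i2 : IntegrableOn (fun t => ‖f t‖ ^ 2) (closedBall y r) := hi2.integrableOn
  have i3 : IntegrableOn (fun t => 2 * (f t * starRingEnd ℂ (f y)).re) (closedBall y r) :=
    (i1.mul_const (starRingEnd ℂ (f y))).re.const_mul 2
  have i4 : IntegrableOn (fun t => ‖f t - f y‖) (closedBall y r) :=
    (i1.sub ((locallyIntegrable_const (f y)).integrableOn_isCompact
      (isCompact_closedBall y r))).norm
  have e1 : ∫ t in closedBall y r, (f t * starRingEnd ℂ (f y)).re
      = ((∫ t in closedBall y r, f t) * starRingEnd ℂ (f y)).re := by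
    rw [← integral_mul_const]
    exact integral_re (i1.mul_const (starRingEnd ℂ (f y)))
  have e2 : ∫ t in closedBall y r, (‖f t - f y‖ + (‖f t‖ ^ 2
        - 2 * (f t * starRingEnd ℂ (f y)).re + ‖f y‖ ^ 2))
      = (∫ t in closedBall y r, ‖f t - f y‖) + ((∫ t in closedBall y r, ‖f t‖ ^ 2)
        - 2 * ((∫ t in closedBall y r, f t) * starRingEnd ℂ (f y)).re
        + volume.real (closedBall y r) * ‖f y‖ ^ 2) := by
    have i5 : IntegrableOn (fun t => ‖f t‖ ^ 2 - 2 * (f t * starRingEnd ℂ (f y)).re)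
      (closedBall y r) := i2.sub i3
    rw [← e1, ← integral_const_mul, ← integral_sub i2 i3, ← smul_eq_mul, ← setIntegral_const,
      ← integral_add i5 (ic _)]
    exact integral_add i4 (i5.add (ic _))
  simp_rw [setAverage_eq, Function.comp_apply, hexp]
  rw [e2]
  simp only [smul_eq_mul, Complex.real_smul, mul_assoc, Complex.re_ofReal_mul]
  field_simp

lemma meanVanishesAt_of_continuousAt {n : ℕ} {f : Conf n → ℂ} {y : Conf n}
    (hf : ContinuousAt f y) :
    MeanVanishesAt (fun t => ENNReal.ofReal (‖f t - f y‖ + ‖f t - f y‖ ^ 2)) y := by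
  apply meanVanishesAt_of_tendsto
  have h : Tendsto (fun t => ‖f t - f y‖ + ‖f t - f y‖ ^ 2) (𝓝 y) (𝓝 0) := by
    have h1 := tendsto_iff_norm_sub_tendsto_zero.1 hf
    simpa using h1.add (h1.pow 2)
  simpa using ENNReal.tendsto_ofReal h

/-- The phase factor `exp(-(i/ħ) s)`. -/
def phase (hbar s : ℝ) : ℂ := Complex.exp (-(Complex.I / (hbar : ℂ)) * (s : ℂ))

lemma phase_eq (hbar s : ℝ) : phase hbar s = Complex.exp (((-(s / hbar) : ℝ) : ℂ) * Complex.I) := by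
  unfold phase
  congr 1
  push_cast
  ring

@[simp] lemma norm_phase (hbar s : ℝ) : ‖phase hbar s‖ = 1 := by
  rw [phase_eq, Complex.norm_exp_ofReal_mul_I]

@[simp] lemma phase_zero (hbar : ℝ) : phase hbar 0 = 1 := by simp [phase]

lemma phase_add (hbar s s' : ℝ) : phase hbar (s + s') = phase hbar s * phase hbar s' := by
  unfold phase
  rw [← Complex.exp_add]
  push_cast
  ring_nf

@[simp] lemma conj_phase (hbar s : ℝ) : starRingEnd ℂ (phase hbar s) = phase hbar (-s) := by
  rw [phase_eq, phase_eq, ← Complex.exp_conj]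
  congr 1
  simp only [map_mul, Complex.conj_ofReal, Complex.conj_I]
  push_cast
  ring

lemma continuous_phase (hbar : ℝ) : Continuous (phase hbar) := by
  unfold phase
  fun_prop

lemma integral_exp_neg_sq_mul_phase {n : ℕ} (hbar : ℝ) {ε : ℝ} (hε : 0 < ε) (t : Conf n) :
    ∫ u : Conf n, ((Real.exp (-ε * ‖u‖ ^ 2) : ℝ) : ℂ) * phase hbar (inner ℝ u t)
      = (((Real.pi / ε) ^ ((n : ℝ) / 2) * Real.exp (-‖t‖ ^ 2 / (4 * hbar ^ 2 * ε)) : ℝ) : ℂ) := by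
  have h := GaussianFourier.integral_cexp_neg_mul_sq_norm_add (V := Conf n) (b := (ε : ℂ))
    (by simpa using hε) (-(Complex.I / (hbar : ℂ))) t
  have e : ∀ u : Conf n, ((Real.exp (-ε * ‖u‖ ^ 2) : ℝ) : ℂ) * phase hbar (inner ℝ u t)
      = Complex.exp (-(ε : ℂ) * ‖u‖ ^ 2 + -(Complex.I / (hbar : ℂ)) * (inner ℝ t u : ℝ)) := by
    intro u
    rw [Complex.exp_add, real_inner_comm u t, phase]
    push_cast
    rfl
  simp_rw [e]
  rw [h, finrank_euclideanSpace_fin]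
  have hpi := Real.pi_pos
  rw [Complex.ofReal_mul, Complex.ofReal_cpow (by positivity), Complex.ofReal_exp]
  push_cast
  congr 2
  rw [neg_sq, div_pow, Complex.I_sq]
  ring

lemma const_mul_gauss_eq {n : ℕ} {hbar : ℝ} (hh : 0 < hbar) {ε : ℝ} (hε : 0 < ε) (t : Conf n) :
    (1 / (2 * Real.pi * hbar)) ^ n *
      ((Real.pi / ε) ^ ((n : ℝ) / 2) * Real.exp (-‖t‖ ^ 2 / (4 * hbar ^ 2 * ε)))
    = gaussKer (1 / (4 * hbar ^ 2 * ε)) t := by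
  have hpi := Real.pi_pos
  have e1 : (1 / (2 * Real.pi * hbar)) ^ n
      = ((1 / (2 * Real.pi * hbar)) ^ (2 : ℝ)) ^ ((n : ℝ) / 2) := by
    rw [← Real.rpow_mul (by positivity), ← Real.rpow_natCast]
    congr 1; ring
  unfold gaussKer
  rw [← mul_assoc, e1, ← Real.mul_rpow (by positivity) (by positivity)]
  congr 2
  · rw [Real.rpow_two]
    field_simp
    norm_num
  · ring

/-- The Fourier integral `∫ exp(-(i/ħ) u·t) F(t) dt`. -/
def fourierInt {n : ℕ} (hbar : ℝ) (F : Conf n → ℂ) (u : Conf n) : ℂ :=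
  ∫ t, phase hbar (inner ℝ u t) * F t

lemma integrable_phase_mul {n : ℕ} {hbar : ℝ} {F : Conf n → ℂ} (hF : Integrable F)
    {s : Conf n → ℝ} (hs : Continuous s) : Integrable (fun t => phase hbar (s t) * F t) :=
  hF.bdd_mul (c := 1) ((continuous_phase hbar).comp hs).aestronglyMeasurable
    (Eventually.of_forall fun t => by simp)

lemma continuous_fourierInt {n : ℕ} {hbar : ℝ} {F : Conf n → ℂ} (hF : Integrable F) :
    Continuous (fourierInt hbar F) := by
  refine continuous_of_dominated (bound := fun t => ‖F t‖) (fun u => ?_) (fun u => ?_) hF.norm ?_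
  · exact (integrable_phase_mul hF (by fun_prop)).aestronglyMeasurable
  · exact Eventually.of_forall fun t => by simp
  · refine Eventually.of_forall fun t => ?_
    exact ((continuous_phase hbar).comp (by fun_prop)).mul continuous_const

lemma integral_gauss_fourierInt {n : ℕ} {hbar : ℝ} (hh : 0 < hbar) {F : Conf n → ℂ}
    (hF : Integrable F) {ε : ℝ} (hε : 0 < ε) :
    (((1 / (2 * Real.pi * hbar) : ℝ) : ℂ)) ^ n *
      ∫ u : Conf n, ((Real.exp (-ε * ‖u‖ ^ 2) : ℝ) : ℂ) * fourierInt hbar F u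
    = ∫ t, (gaussKer (1 / (4 * hbar ^ 2 * ε)) t : ℂ) * F t := by
  have hprod : Integrable (Function.uncurry fun (u t : Conf n) =>
      ((Real.exp (-ε * ‖u‖ ^ 2) : ℝ) : ℂ) * (phase hbar (inner ℝ u t) * F t))
      (volume.prod volume) := by
    have h1 : Integrable (fun z : Conf n × Conf n =>
        ((Real.exp (-ε * ‖z.1‖ ^ 2) : ℝ) : ℂ) * F z.2) (volume.prod volume) :=
      (integrable_exp_neg_sq hε).ofReal.mul_prod hF
    have hc : Continuous fun z : Conf n × Conf n => phase hbar (inner ℝ z.1 z.2) :=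
      (continuous_phase hbar).comp (by fun_prop)
    refine (h1.bdd_mul (c := 1) hc.aestronglyMeasurable
      (Eventually.of_forall fun t => by simp)).congr (Eventually.of_forall fun z => ?_)
    simp only [Function.uncurry]
    ring
  unfold fourierInt
  simp_rw [← integral_const_mul]
  rw [integral_integral_swap (by
    simpa [Function.uncurry_def, mul_assoc] using hprod.const_mul
      ((((1 / (2 * Real.pi * hbar) : ℝ) : ℂ)) ^ n))]
  refine integral_congr_ae (Eventually.of_forall fun t => ?_)
  simp only
  rw [← const_mul_gauss_eq hh hε, Complex.ofReal_mul, ← integral_exp_neg_sq_mul_phase hbar hε,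
    Complex.ofReal_pow, mul_assoc (_ ^ n) _ (F t), ← integral_mul_const, ← integral_const_mul]
  refine integral_congr_ae (Eventually.of_forall fun u => ?_)
  simp only
  ring

lemma tendsto_inv_mul_atTop {hbar : ℝ} (hh : 0 < hbar) :
    Tendsto (fun ε : ℝ => 1 / (4 * hbar ^ 2 * ε)) (𝓝[>] 0) atTop := by
  have h : Tendsto (fun ε : ℝ => (1 / (4 * hbar ^ 2)) * ε⁻¹) (𝓝[>] 0) atTop :=
    tendsto_inv_nhdsGT_zero.const_mul_atTop (by positivity)
  refine h.congr fun ε => ?_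
  rw [one_div, one_div, ← mul_inv]

lemma MeanVanishesAt.phase_mul {n : ℕ} {F : Conf n → ℂ} (hF : Integrable F) {c : ℂ}
    (hv : MeanVanishesAt (fun t => ‖F t - c‖ₑ) 0) (hbar : ℝ) (q : Conf n) :
    MeanVanishesAt (fun t => ‖phase hbar (inner ℝ q t) * F t - c‖ₑ) 0 := by
  have h2 : MeanVanishesAt (fun t : Conf n => ‖phase hbar (inner ℝ q t) * c - c‖ₑ) 0 := by
    apply meanVanishesAt_of_tendsto
    have hc : Continuous fun t : Conf n => ‖phase hbar (inner ℝ q t) * c - c‖ₑ :=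
      ((((continuous_phase hbar).comp (by fun_prop)).mul continuous_const).sub
        continuous_const).enorm
    simpa using hc.tendsto 0
  refine (hv.add (hF.aestronglyMeasurable.sub aestronglyMeasurable_const).enorm h2).mono
    fun t => ?_
  have : phase hbar (inner ℝ q t) * F t - c
      = phase hbar (inner ℝ q t) * (F t - c) + (phase hbar (inner ℝ q t) * c - c) := by ring
  rw [this]
  refine (enorm_add_le _ _).trans_eq ?_
  rw [enorm_mul, ← ofReal_norm (phase hbar _), norm_phase, ENNReal.ofReal_one, one_mul]
  rfl

/-- Abel–Gauss summation of the Fourier inversion integral at a Lebesgue point. -/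
lemma tendsto_gauss_fourierInt {n : ℕ} {hbar : ℝ} (hh : 0 < hbar) {F : Conf n → ℂ}
    (hF : Integrable F) {c : ℂ} (hv : MeanVanishesAt (fun t => ‖F t - c‖ₑ) 0) (q : Conf n) :
    Tendsto (fun ε : ℝ => ∫ u : Conf n, ((Real.exp (-ε * ‖u‖ ^ 2) : ℝ) : ℂ) *
      ((((1 / (2 * Real.pi * hbar) : ℝ) : ℂ)) ^ n * fourierInt hbar F (u + q)))
      (𝓝[>] 0) (𝓝 c) := by
  have hF' : Integrable (fun t => phase hbar (inner ℝ q t) * F t) :=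
    integrable_phase_mul hF (by fun_prop)
  have h := (tendsto_integral_gaussKer hF' (hv.phase_mul hF hbar q)).comp
    (tendsto_inv_mul_atTop hh)
  refine h.congr' ?_
  filter_upwards [self_mem_nhdsWithin] with ε hε
  rw [Function.comp_apply, ← integral_gauss_fourierInt hh hF' hε, ← integral_const_mul]
  refine integral_congr_ae (Eventually.of_forall fun u => ?_)
  have e : fourierInt hbar (fun t => phase hbar (inner ℝ q t) * F t) u
      = fourierInt hbar F (u + q) := by
    unfold fourierInt
    simp_rw [inner_add_left, phase_add, mul_assoc]
  simp only [e]
  ring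

lemma tendsto_gauss_integral {n : ℕ} {Φ : Conf n → ℂ} (hΦ : Integrable Φ) :
    Tendsto (fun ε : ℝ => ∫ u : Conf n, ((Real.exp (-ε * ‖u‖ ^ 2) : ℝ) : ℂ) * Φ u)
      (𝓝[>] 0) (𝓝 (∫ u, Φ u)) := by
  refine tendsto_integral_filter_of_dominated_convergence (fun u => ‖Φ u‖) ?_ ?_ hΦ.norm ?_
  · refine Eventually.of_forall fun ε => ?_
    have hc : Continuous fun u : Conf n => ((Real.exp (-ε * ‖u‖ ^ 2) : ℝ) : ℂ) := by fun_prop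
    exact hc.aestronglyMeasurable.mul hΦ.aestronglyMeasurable
  · filter_upwards [self_mem_nhdsWithin] with ε hε
    refine Eventually.of_forall fun u => ?_
    rw [norm_mul, Complex.norm_real, Real.norm_of_nonneg (Real.exp_nonneg _)]
    refine mul_le_of_le_one_left (norm_nonneg _) (Real.exp_le_one_iff.2 ?_)
    have hε : 0 < ε := hε
    nlinarith [sq_nonneg ‖u‖]
  · refine Eventually.of_forall fun u => ?_
    have hc : Continuous fun ε : ℝ => ((Real.exp (-ε * ‖u‖ ^ 2) : ℝ) : ℂ) * Φ u := by fun_prop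
    have := hc.tendsto 0
    simp only [neg_zero, zero_mul, Real.exp_zero, Complex.ofReal_one, one_mul] at this
    exact this.mono_left nhdsWithin_le_nhds

lemma integral_fourierInt_eq {n : ℕ} {hbar : ℝ} (hh : 0 < hbar) {F : Conf n → ℂ}
    (hF : Integrable F) {c : ℂ} (hv : MeanVanishesAt (fun t => ‖F t - c‖ₑ) 0) (q : Conf n)
    (hi : Integrable fun u => (((1 / (2 * Real.pi * hbar) : ℝ) : ℂ)) ^ n *
      fourierInt hbar F (u + q)) :
    ∫ u, (((1 / (2 * Real.pi * hbar) : ℝ) : ℂ)) ^ n * fourierInt hbar F (u + q) = c :=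
  tendsto_nhds_unique (tendsto_gauss_integral hi) (tendsto_gauss_fourierInt hh hF hv q)

/-- Fourier inversion at a Lebesgue point. -/
lemma fourierInt_inversion_of_meanVanishesAt {n : ℕ} {hbar : ℝ} (hh : 0 < hbar) {F : Conf n → ℂ}
    (hF : Integrable F) (hi : Integrable (fourierInt hbar F)) {y : Conf n}
    (hv : MeanVanishesAt (fun t => ‖F t - F y‖ₑ) y) :
    (((1 / (2 * Real.pi * hbar) : ℝ) : ℂ)) ^ n *
      ∫ u, phase hbar (-inner ℝ u y) * fourierInt hbar F u = F y := by
  have hv := hv.comp_affine one_ne_zero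
  simp only [one_smul] at hv
  have hshift : ∀ u, fourierInt hbar (fun t => F (y + t)) u
      = phase hbar (-inner ℝ u y) * fourierInt hbar F u := fun u => by
    unfold fourierInt
    rw [← integral_const_mul, ← integral_add_left_eq_self
      (fun t => phase hbar (-inner ℝ u y) * (phase hbar (inner ℝ u t) * F t)) y]
    refine integral_congr_ae (Eventually.of_forall fun t => ?_)
    simp only
    rw [inner_add_right, phase_add, ← mul_assoc, ← mul_assoc, ← phase_add]
    simp
  have hFy : Integrable fun t => F (y + t) := hF.comp_add_left y
  have key := integral_fourierInt_eq hh hFy hv 0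
  simp only [add_zero, hshift] at key
  rw [← integral_const_mul, key]
  exact (integrable_phase_mul hi (by fun_prop)).const_mul _

/-- Fourier inversion almost everywhere. -/
lemma ae_fourierInt_inversion {n : ℕ} {hbar : ℝ} (hh : 0 < hbar) {F : Conf n → ℂ}
    (hF : Integrable F) (hi : Integrable (fourierInt hbar F)) :
    ∀ᵐ y, (((1 / (2 * Real.pi * hbar) : ℝ) : ℂ)) ^ n *
      ∫ u, phase hbar (-inner ℝ u y) * fourierInt hbar F u = F y := by
  filter_upwards [IsUnifLocDoublingMeasure.ae_tendsto_average_norm_sub volume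
    hF.locallyIntegrable 1] with y h1
  have hmem : ∀ᶠ r in 𝓝[>] (0 : ℝ), y ∈ closedBall y (1 * r) := by
    filter_upwards [self_mem_nhdsWithin] with r hr
    rw [one_mul]
    exact Metric.mem_closedBall_self (le_of_lt hr)
  have h1 := h1 (fun _ => y) (fun r => r) tendsto_id hmem
  have hloc : LocallyIntegrable fun t => ‖F t - F y‖ := fun x => by
    obtain ⟨s, hs, hi⟩ := hF.locallyIntegrable.sub (locallyIntegrable_const (F y)) x
    exact ⟨s, hs, hi.norm⟩
  have hv := tendsto_closedBall_average_meanVanishesAt hloc (fun _ => norm_nonneg _) h1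
  simp only [ofReal_norm] at hv
  exact fourierInt_inversion_of_meanVanishesAt hh hF hi hv

/-- Fourier inversion at a point of continuity. -/
lemma fourierInt_inversion_of_continuousAt {n : ℕ} {hbar : ℝ} (hh : 0 < hbar) {F : Conf n → ℂ}
    (hF : Integrable F) (hi : Integrable (fourierInt hbar F)) {y : Conf n}
    (hy : ContinuousAt F y) :
    (((1 / (2 * Real.pi * hbar) : ℝ) : ℂ)) ^ n *
      ∫ u, phase hbar (-inner ℝ u y) * fourierInt hbar F u = F y := by
  refine fourierInt_inversion_of_meanVanishesAt hh hF hi (meanVanishesAt_of_tendsto ?_)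
  simpa [edist_eq_enorm_sub] using tendsto_iff_edist_tendsto_0.1 hy.tendsto

lemma quasiMeasurePreserving_affine {n : ℕ} (y : Conf n) {a : ℝ} (ha : a ≠ 0) :
    Measure.QuasiMeasurePreserving (fun t : Conf n => y + a • t) volume volume := by
  refine ⟨by fun_prop, ?_⟩
  rw [map_affine y ha]
  exact Measure.smul_absolutelyContinuous

lemma memLp_comp_affine {n : ℕ} {f : Conf n → ℂ} {q : ℝ≥0∞} (hf : MemLp f q volume)
    (y : Conf n) {a : ℝ} (ha : a ≠ 0) : MemLp (fun t => f (y + a • t)) q volume := by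
  have h := hf.smul_measure (c := ENNReal.ofReal |(a ^ n)⁻¹|) ENNReal.ofReal_ne_top
  rw [← map_affine y ha] at h
  exact (measurableEmbedding_affine y ha).memLp_map_measure_iff.1 h

lemma integral_comp_affine {n : ℕ} (G : Conf n → ℂ) (y : Conf n) (a : ℝ) :
    ∫ t, G (y + a • t) = |(a ^ n)⁻¹| • ∫ t, G t := by
  have h := Measure.integral_comp_smul (volume : Measure (Conf n)) (fun t => G (y + t)) a
  rw [finrank_euclideanSpace_fin, integral_add_left_eq_self] at h
  exact h

lemma sub_half_eq {n : ℕ} (x y : Conf n) :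
    x - (1 / 2 : ℝ) • y = x + (-1 / 2 : ℝ) • y := by
  rw [neg_div, neg_smul, sub_eq_add_neg]

/-- The function `y ↦ f(x + y/2) conj(h(x - y/2))`. -/
def crossProd {n : ℕ} (f h : Conf n → ℂ) (x y : Conf n) : ℂ :=
  f (x + (1 / 2 : ℝ) • y) * starRingEnd ℂ (h (x - (1 / 2 : ℝ) • y))

lemma wigner_eq {n : ℕ} (hbar : ℝ) (f : Conf n → ℂ) (x p : Conf n) :
    wigner hbar f x p = (((1 / (2 * Real.pi * hbar) : ℝ) : ℂ)) ^ n *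
      fourierInt hbar (crossProd f f x) p := by
  unfold wigner fourierInt crossProd phase
  simp_rw [mul_assoc]

lemma crossProd_congr {n : ℕ} {f f' h h' : Conf n → ℂ} (hf : f =ᵐ[volume] f')
    (hh : h =ᵐ[volume] h') (x : Conf n) : crossProd f h x =ᵐ[volume] crossProd f' h' x := by
  have h1 := (quasiMeasurePreserving_affine x (a := 1 / 2) (by norm_num)).ae_eq_comp hf
  have h2 := (quasiMeasurePreserving_affine x (a := -1 / 2) (by norm_num)).ae_eq_comp hh
  filter_upwards [h1, h2] with y e1 e2
  simp only [Function.comp_apply] at e1 e2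
  simp only [crossProd, sub_half_eq, e1, e2]

lemma fourierInt_congr {n : ℕ} {hbar : ℝ} {F G : Conf n → ℂ} (h : F =ᵐ[volume] G) (u : Conf n) :
    fourierInt hbar F u = fourierInt hbar G u :=
  integral_congr_ae (h.mono fun t ht => by simp only [ht])

lemma wigner_congr {n : ℕ} {hbar : ℝ} {f g : Conf n → ℂ} (h : f =ᵐ[volume] g) (x p : Conf n) :
    wigner hbar f x p = wigner hbar g x p := by
  rw [wigner_eq, wigner_eq, fourierInt_congr (crossProd_congr h h x)]

lemma integrable_crossProd {n : ℕ} {f h : Conf n → ℂ} (hf : MemLp f 2 volume)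
    (hh : MemLp h 2 volume) (x : Conf n) : Integrable (crossProd f h x) := by
  have h1 := memLp_comp_affine hf x (a := 1 / 2) (by norm_num)
  have h2 := memLp_comp_affine hh x (a := -1 / 2) (by norm_num)
  simp_rw [← sub_half_eq] at h2
  exact h1.integrable_mul h2.star

lemma crossProd_sub_le (a b c : ℂ) :
    ‖a * starRingEnd ℂ b - ((‖c‖ ^ 2 : ℝ) : ℂ)‖ ≤ (1 + ‖c‖) *
      ((‖a - c‖ + ‖a - c‖ ^ 2) + (‖b - c‖ + ‖b - c‖ ^ 2)) := by
  have e : a * starRingEnd ℂ b - ((‖c‖ ^ 2 : ℝ) : ℂ) = (a - c) * starRingEnd ℂ (b - c)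
      + c * starRingEnd ℂ (b - c) + (a - c) * starRingEnd ℂ c := by
    rw [← Complex.normSq_eq_norm_sq, ← Complex.mul_conj, map_sub]
    ring
  rw [e]
  refine (norm_add₃_le).trans ?_
  simp only [norm_mul, RCLike.norm_conj]
  nlinarith [norm_nonneg (a - c), norm_nonneg (b - c), norm_nonneg c,
    sq_nonneg (‖a - c‖ - ‖b - c‖), mul_nonneg (norm_nonneg c) (sq_nonneg ‖a - c‖),
    mul_nonneg (norm_nonneg c) (sq_nonneg ‖b - c‖)]

lemma meanVanishesAt_crossProd {n : ℕ} {f : Conf n → ℂ} (hf : MemLp f 2 volume) {y : Conf n}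
    (hv : MeanVanishesAt (fun t => ENNReal.ofReal (‖f t - f y‖ + ‖f t - f y‖ ^ 2)) y) :
    MeanVanishesAt (fun t => ‖crossProd f f y t - ((‖f y‖ ^ 2 : ℝ) : ℂ)‖ₑ) 0 := by
  have h1 := hv.comp_affine (a := 1 / 2) (by norm_num)
  have h2 := hv.comp_affine (a := -1 / 2) (by norm_num)
  have hm : AEMeasurable fun t => ENNReal.ofReal (‖f (y + (1 / 2 : ℝ) • t) - f y‖
      + ‖f (y + (1 / 2 : ℝ) • t) - f y‖ ^ 2) := by
    have hs : AEStronglyMeasurable (fun t => f (y + (1 / 2 : ℝ) • t) - f y) :=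
      (memLp_comp_affine hf y (by norm_num)).aestronglyMeasurable.sub
        aestronglyMeasurable_const
    exact (hs.norm.aemeasurable.add (hs.norm.aemeasurable.pow_const 2)).ennreal_ofReal
  refine ((h1.add hm h2).const_mul (1 + ‖f y‖₊)).mono fun t => ?_
  rw [← ofReal_norm, ← ENNReal.ofReal_add (by positivity) (by positivity),
    ← ENNReal.ofReal_coe_nnreal, ← ENNReal.ofReal_mul (by positivity)]
  refine ENNReal.ofReal_le_ofReal ?_
  rw [← sub_half_eq]
  exact crossProd_sub_le _ _ _

/-- Gaussian sums of the Wigner transform over momenta at a Lebesgue point. -/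
lemma tendsto_gauss_wigner {n : ℕ} {hbar : ℝ} (hh : 0 < hbar) {f : Conf n → ℂ}
    (hf : MemLp f 2 volume) {y : Conf n}
    (hv : MeanVanishesAt (fun t => ENNReal.ofReal (‖f t - f y‖ + ‖f t - f y‖ ^ 2)) y)
    (q : Conf n) :
    Tendsto (fun ε : ℝ => ∫ u : Conf n, ((Real.exp (-ε * ‖u‖ ^ 2) : ℝ) : ℂ) *
      wigner hbar f y (u + q)) (𝓝[>] 0) (𝓝 ((‖f y‖ ^ 2 : ℝ) : ℂ)) := by
  simp_rw [wigner_eq]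
  exact tendsto_gauss_fourierInt hh (integrable_crossProd hf hf y)
    (meanVanishesAt_crossProd hf hv) q

lemma integral_wigner_eq {n : ℕ} {hbar : ℝ} (hh : 0 < hbar) {f : Conf n → ℂ}
    (hf : MemLp f 2 volume) {y : Conf n}
    (hv : MeanVanishesAt (fun t => ENNReal.ofReal (‖f t - f y‖ + ‖f t - f y‖ ^ 2)) y)
    (q : Conf n) (hi : Integrable fun u => wigner hbar f y (u + q)) :
    ∫ u, wigner hbar f y (u + q) = ((‖f y‖ ^ 2 : ℝ) : ℂ) :=
  tendsto_nhds_unique (tendsto_gauss_integral hi) (tendsto_gauss_wigner hh hf hv q)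

/-! ### Continuity of the Wigner transform in the wave function -/

lemma exists_eLpNorm_comp_affine_le {n : ℕ} (x : Conf n) {a : ℝ} (ha : a ≠ 0) :
    ∃ C : ℝ≥0, ∀ f : Conf n → ℂ,
      eLpNorm (fun t => f (x + a • t)) 2 volume ≤ C * eLpNorm f 2 volume := by
  refine ⟨|(a ^ n)⁻¹|.toNNReal ^ ((1 / 2 : ℝ≥0∞).toReal), fun f => le_of_eq ?_⟩
  have := (measurableEmbedding_affine x ha).eLpNorm_map_measure (g := f) (p := 2)
    (μ := volume)
  rw [map_affine x ha, eLpNorm_smul_measure_of_ne_top (by norm_num)] at this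
  rw [ENNReal.coe_rpow_of_nonneg _ (by positivity)]
  exact this.symm

lemma exists_norm_fourierInt_crossProd_le {n : ℕ} (hbar : ℝ) (x p : Conf n) :
    ∃ C : ℝ, 0 < C ∧ ∀ f h : L2 n, ‖fourierInt hbar (crossProd f h x) p‖ ≤ C * ‖f‖ * ‖h‖ := by
  obtain ⟨C₁, hC₁⟩ := exists_eLpNorm_comp_affine_le x (a := 1 / 2) (by norm_num)
  obtain ⟨C₂, hC₂⟩ := exists_eLpNorm_comp_affine_le x (a := -1 / 2) (by norm_num)
  refine ⟨C₁ * C₂ + 1, by positivity, fun f h => ?_⟩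
  have m1 := (memLp_comp_affine (Lp.memLp f) x (a := 1 / 2) (by norm_num))
  have m2 := (memLp_comp_affine (Lp.memLp h) x (a := -1 / 2) (by norm_num))
  have hle : ‖fourierInt hbar (crossProd f h x) p‖ₑ
      ≤ (C₁ * eLpNorm f 2 volume) * (C₂ * eLpNorm h 2 volume) := by
    refine (enorm_integral_le_lintegral_enorm _).trans ?_
    have e : ∀ t, ‖phase hbar (inner ℝ p t) * crossProd f h x t‖ₑ
        = ‖(fun t => f (x + (1 / 2 : ℝ) • t)) t * (fun t => h (x + (-1 / 2 : ℝ) • t)) t‖ₑ := by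
      intro t
      rw [← ofReal_norm, ← ofReal_norm]
      simp [crossProd, ← sub_half_eq]
    simp_rw [e]
    rw [← eLpNorm_one_eq_lintegral_enorm]
    refine (eLpNorm_smul_le_mul_eLpNorm (p := 2) (q := 2) (r := 1) m2.1 m1.1).trans ?_
    exact mul_le_mul' (hC₁ f) (hC₂ h)
  have := ENNReal.toReal_mono (by finiteness [Lp.eLpNorm_ne_top f, Lp.eLpNorm_ne_top h]) hle
  rw [toReal_enorm, ENNReal.toReal_mul, ENNReal.toReal_mul, ENNReal.toReal_mul] at this
  rw [Lp.norm_def, Lp.norm_def]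
  simp only [ENNReal.coe_toReal] at this
  nlinarith [mul_nonneg (ENNReal.toReal_nonneg (a := eLpNorm f 2 volume))
    (ENNReal.toReal_nonneg (a := eLpNorm h 2 volume))]

lemma continuous_wigner {n : ℕ} (hbar : ℝ) (x p : Conf n) :
    Continuous fun ψ : L2 n => wigner hbar ψ x p := by
  simp_rw [wigner_eq]
  refine continuous_const.mul ?_
  obtain ⟨C, hC0, hC⟩ := exists_norm_fourierInt_crossProd_le hbar x p
  have hint : ∀ f h : L2 n, Integrable fun t => phase hbar (inner ℝ p t) * crossProd f h x t :=
    fun f h => integrable_phase_mul (integrable_crossProd (Lp.memLp f) (Lp.memLp h) x)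
      (by fun_prop)
  have hB : IsBoundedBilinearMap ℝ
      (fun z : L2 n × L2 n => fourierInt hbar (crossProd z.1 z.2 x) p) := by
    refine ⟨fun f₁ f₂ h => ?_, fun c f h => ?_, fun f h₁ h₂ => ?_, fun c f h => ?_, C, hC0, hC⟩
    · rw [fourierInt_congr (crossProd_congr (Lp.coeFn_add f₁ f₂) EventuallyEq.rfl x)]
      unfold fourierInt
      rw [← integral_add (hint _ _) (hint _ _)]
      congr 1; ext t; simp only [crossProd, Pi.add_apply]; ring
    · rw [fourierInt_congr (crossProd_congr (Lp.coeFn_smul c f) EventuallyEq.rfl x)]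
      unfold fourierInt
      rw [← integral_smul]
      congr 1; ext t; simp only [crossProd, Pi.smul_apply, Complex.real_smul]; ring
    · rw [fourierInt_congr (crossProd_congr EventuallyEq.rfl (Lp.coeFn_add h₁ h₂) x)]
      unfold fourierInt
      rw [← integral_add (hint _ _) (hint _ _)]
      congr 1; ext t; simp only [crossProd, Pi.add_apply, map_add]; ring
    · rw [fourierInt_congr (crossProd_congr EventuallyEq.rfl (Lp.coeFn_smul c h) x)]
      unfold fourierInt
      rw [← integral_smul]
      congr 1; ext t
      simp only [crossProd, Pi.smul_apply, Complex.real_smul, map_mul, Complex.conj_ofReal]; ring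
  exact hB.continuous.comp (continuous_id.prodMk continuous_id)

/-! ### Matrices acting on `ℝⁿ` -/

lemma act_mul {n : ℕ} (A B : Matrix (Fin n) (Fin n) ℝ) (x : Conf n) :
    act (A * B) x = act A (act B x) := by simp [act]

lemma act_add_matrix {n : ℕ} (A B : Matrix (Fin n) (Fin n) ℝ) (x : Conf n) :
    act (A + B) x = act A x + act B x := by simp [act]

lemma act_neg_matrix {n : ℕ} (A : Matrix (Fin n) (Fin n) ℝ) (x : Conf n) :
    act (-A) x = -act A x := by simp [act]

lemma act_one {n : ℕ} (x : Conf n) : act (1 : Matrix (Fin n) (Fin n) ℝ) x = x := by simp [act]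

lemma act_zero {n : ℕ} (x : Conf n) : act (0 : Matrix (Fin n) (Fin n) ℝ) x = 0 := by simp [act]

lemma act_add {n : ℕ} (A : Matrix (Fin n) (Fin n) ℝ) (x y : Conf n) :
    act A (x + y) = act A x + act A y := by simp [act]

lemma act_sub {n : ℕ} (A : Matrix (Fin n) (Fin n) ℝ) (x y : Conf n) :
    act A (x - y) = act A x - act A y := by simp [act]

lemma act_neg {n : ℕ} (A : Matrix (Fin n) (Fin n) ℝ) (x : Conf n) :
    act A (-x) = -act A x := by simp [act]

lemma act_smul {n : ℕ} (A : Matrix (Fin n) (Fin n) ℝ) (c : ℝ) (x : Conf n) :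
    act A (c • x) = c • act A x := by simp [act]

lemma inner_act {n : ℕ} (A : Matrix (Fin n) (Fin n) ℝ) (x y : Conf n) :
    inner ℝ (act A.transpose x) y = inner ℝ x (act A y) := by
  unfold act
  rw [← Matrix.conjTranspose_eq_transpose_of_trivial,
    Matrix.toEuclideanLin_conjTranspose_eq_adjoint, LinearMap.adjoint_inner_left]

lemma det_toEuclideanLin {n : ℕ} (A : Matrix (Fin n) (Fin n) ℝ) :
    LinearMap.det (Matrix.toEuclideanLin A) = A.det := by
  simp

lemma integral_comp_act {n : ℕ} {A : Matrix (Fin n) (Fin n) ℝ} (hA : A.det ≠ 0)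
    (G : Conf n → ℂ) : ((|A.det| : ℝ) : ℂ) * ∫ x, G (act A x) = ∫ x, G x := by
  have hdet : LinearMap.det (Matrix.toEuclideanLin A) ≠ 0 := by rwa [det_toEuclideanLin]
  have hmap := Measure.map_linearMap_addHaar_eq_smul_addHaar (volume : Measure (Conf n)) hdet
  have hemb : MeasurableEmbedding (Matrix.toEuclideanLin A) :=
    ((LinearMap.equivOfDetNeZero _ hdet).toContinuousLinearEquiv).toHomeomorph.measurableEmbedding
  have h := hemb.integral_map (μ := volume) G
  rw [hmap, integral_smul_measure, det_toEuclideanLin,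
    ENNReal.toReal_ofReal (abs_nonneg _), abs_inv] at h
  unfold act
  rw [← h, Complex.real_smul, ← mul_assoc, ← Complex.ofReal_mul,
    mul_inv_cancel₀ (abs_ne_zero.2 hA), Complex.ofReal_one, one_mul]

/-! ### Symplectic covariance of the Wigner transform -/

/-- The position part of the image of `(x, p)` by a block matrix. -/
def posPart {n : ℕ} (S : Matrix (Fin n ⊕ Fin n) (Fin n ⊕ Fin n) ℝ) (x p : Conf n) : Conf n :=
  act S.toBlocks₁₁ x + act S.toBlocks₁₂ p

/-- The momentum part of the image of `(x, p)` by a block matrix. -/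
def momPart {n : ℕ} (S : Matrix (Fin n ⊕ Fin n) (Fin n ⊕ Fin n) ℝ) (x p : Conf n) : Conf n :=
  act S.toBlocks₂₁ x + act S.toBlocks₂₂ p

lemma posPart_mul {n : ℕ} (S S' : Matrix (Fin n ⊕ Fin n) (Fin n ⊕ Fin n) ℝ) (x p : Conf n) :
    posPart (S * S') x p = posPart S (posPart S' x p) (momPart S' x p) := by
  rw [← Matrix.fromBlocks_toBlocks S, ← Matrix.fromBlocks_toBlocks S',
    Matrix.fromBlocks_multiply]
  simp only [posPart, momPart, Matrix.toBlocks_fromBlocks₁₁, Matrix.toBlocks_fromBlocks₁₂,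
    Matrix.toBlocks_fromBlocks₂₁, Matrix.toBlocks_fromBlocks₂₂, act_add_matrix, act_mul, act_add]
  abel

lemma momPart_mul {n : ℕ} (S S' : Matrix (Fin n ⊕ Fin n) (Fin n ⊕ Fin n) ℝ) (x p : Conf n) :
    momPart (S * S') x p = momPart S (posPart S' x p) (momPart S' x p) := by
  rw [← Matrix.fromBlocks_toBlocks S, ← Matrix.fromBlocks_toBlocks S',
    Matrix.fromBlocks_multiply]
  simp only [posPart, momPart, Matrix.toBlocks_fromBlocks₁₁, Matrix.toBlocks_fromBlocks₁₂,
    Matrix.toBlocks_fromBlocks₂₁, Matrix.toBlocks_fromBlocks₂₂, act_add_matrix, act_mul, act_add]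
  abel

lemma posPart_one {n : ℕ} (x p : Conf n) : posPart 1 x p = x := by
  rw [← Matrix.fromBlocks_one]
  simp only [posPart, Matrix.toBlocks_fromBlocks₁₁, Matrix.toBlocks_fromBlocks₁₂, act_one,
    act_zero, add_zero]

lemma momPart_one {n : ℕ} (x p : Conf n) : momPart 1 x p = p := by
  rw [← Matrix.fromBlocks_one]
  simp only [momPart, Matrix.toBlocks_fromBlocks₂₁, Matrix.toBlocks_fromBlocks₂₂, act_one,
    act_zero, zero_add]

/-- The operator `T` moves Wigner transforms by the matrix `S`. -/
def Covariant {n : ℕ} (hbar : ℝ) (T : L2 n → L2 n)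
    (S : Matrix (Fin n ⊕ Fin n) (Fin n ⊕ Fin n) ℝ) : Prop :=
  ∀ (ψ : L2 n) (x p : Conf n),
    wigner hbar (T ψ) (posPart S x p) (momPart S x p) = wigner hbar ψ x p

lemma covariant_chirp {n : ℕ} {hbar : ℝ} {P : Matrix (Fin n) (Fin n) ℝ} (hP : P.IsSymm)
    {T : L2 n ≃ₗᵢ[ℂ] L2 n} (hT : IsChirp hbar P T) :
    Covariant hbar T (Matrix.fromBlocks 1 0 P 1) := by
  intro ψ x p
  simp only [posPart, momPart, Matrix.toBlocks_fromBlocks₁₁, Matrix.toBlocks_fromBlocks₁₂,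
    Matrix.toBlocks_fromBlocks₂₁, Matrix.toBlocks_fromBlocks₂₂, act_one, act_zero, add_zero]
  rw [wigner_congr (hT ψ), wigner_eq, wigner_eq]
  congr 1
  refine integral_congr_ae (Eventually.of_forall fun y => ?_)
  have e : ∀ v : Conf n,
      Complex.exp (Complex.I / (2 * (hbar : ℂ)) * ((inner ℝ (act P v) v : ℝ) : ℂ))
      = phase hbar (-(1 / 2) * inner ℝ (act P v) v) := fun v => by
    unfold phase
    congr 1
    push_cast
    ring
  simp only [crossProd, e, map_mul, conj_phase]
  have h1 : inner ℝ (act P y) x = inner ℝ (act P x) y := by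
    conv_lhs => rw [← hP.eq]
    rw [inner_act, real_inner_comm]
  have h2 : inner ℝ (act P x + p) y + (-(1 / 2) * inner ℝ (act P (x + (1 / 2 : ℝ) • y))
        (x + (1 / 2 : ℝ) • y)) + -(-(1 / 2) * inner ℝ (act P (x - (1 / 2 : ℝ) • y))
        (x - (1 / 2 : ℝ) • y)) = inner ℝ p y := by
    simp only [act_add, act_sub, act_smul, inner_add_left, inner_add_right, inner_sub_left,
      inner_sub_right, inner_smul_left, inner_smul_right, h1]
    simp only [conj_trivial]
    ring
  rw [← h2, phase_add, phase_add]
  ring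

lemma covariant_dilation {n : ℕ} {hbar : ℝ} {L : Matrix (Fin n) (Fin n) ℝ} {m : ℤ}
    (hL : L.det ≠ 0) {T : L2 n ≃ₗᵢ[ℂ] L2 n} (hT : IsDilation L m T) :
    Covariant hbar T (Matrix.fromBlocks L⁻¹ 0 0 L.transpose) := by
  intro ψ x p
  simp only [posPart, momPart, Matrix.toBlocks_fromBlocks₁₁, Matrix.toBlocks_fromBlocks₁₂,
    Matrix.toBlocks_fromBlocks₂₁, Matrix.toBlocks_fromBlocks₂₂, act_zero, add_zero, zero_add]
  rw [wigner_congr (hT ψ), wigner_eq, wigner_eq]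
  congr 1
  unfold fourierInt
  rw [← integral_comp_act hL (fun y => phase hbar (inner ℝ p y) * crossProd ψ ψ x y),
    ← integral_const_mul]
  refine integral_congr_ae (Eventually.of_forall fun y => ?_)
  have hinv : act L (act L⁻¹ x) = x := by
    rw [← act_mul, Matrix.mul_nonsing_inv _ (isUnit_iff_ne_zero.2 hL), act_one]
  have hI : Complex.I ^ m * starRingEnd ℂ (Complex.I ^ m) = 1 := by
    rw [Complex.mul_conj, Complex.normSq_eq_norm_sq, norm_zpow, Complex.norm_I, one_zpow]
    simp
  have hs : ((Real.sqrt |L.det| : ℝ) : ℂ) * ((Real.sqrt |L.det| : ℝ) : ℂ)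
      = ((|L.det| : ℝ) : ℂ) := by
    rw [← Complex.ofReal_mul, Real.mul_self_sqrt (abs_nonneg _)]
  simp only [crossProd, act_add, act_sub, act_smul, hinv, inner_act, map_mul, Complex.conj_ofReal]
  calc _ = (Complex.I ^ m * starRingEnd ℂ (Complex.I ^ m)) *
        (((Real.sqrt |L.det| : ℝ) : ℂ) * ((Real.sqrt |L.det| : ℝ) : ℂ)) *
        (phase hbar (inner ℝ p (act L y)) * (ψ (x + (1 / 2 : ℝ) • act L y) *
          starRingEnd ℂ (ψ (x - (1 / 2 : ℝ) • act L y)))) := by ring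
    _ = _ := by rw [hI, hs, one_mul]

/-! ### The Fourier transform -/

lemma fourierInt_eq_fourier {n : ℕ} {hbar : ℝ} (hh : 0 < hbar) (F : Conf n → ℂ) (u : Conf n) :
    fourierInt hbar F u = 𝓕 F ((1 / (2 * Real.pi * hbar)) • u) := by
  rw [Real.fourier_eq']
  unfold fourierInt
  refine integral_congr_ae (Eventually.of_forall fun t => ?_)
  have := Real.pi_pos
  simp only [smul_eq_mul, phase_eq]
  rw [inner_smul_right, real_inner_comm u t]
  congr 4
  field_simp

lemma integrable_fourierInt_schwartz {n : ℕ} {hbar : ℝ} (hh : 0 < hbar) (ψ : 𝓢(Conf n, ℂ)) :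
    Integrable (fourierInt hbar ψ) := by
  have := Real.pi_pos
  have h : Integrable (𝓕 (ψ : Conf n → ℂ)) := by
    rw [← SchwartzMap.fourier_coe]
    exact (𝓕 ψ).integrable
  have h2 := h.comp_smul (R := 1 / (2 * Real.pi * hbar)) (by positivity)
  exact h2.congr (Eventually.of_forall fun u => (fourierInt_eq_fourier hh ψ u).symm)

lemma fourierInt_crossProd_fourierInt {n : ℕ} {hbar : ℝ} (hh : 0 < hbar) (ψ : 𝓢(Conf n, ℂ))
    (x p : Conf n) :
    (((1 / (2 * Real.pi * hbar) : ℝ) : ℂ)) ^ n *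
      fourierInt hbar (crossProd (fourierInt hbar ψ) (fourierInt hbar ψ) p) (-x)
    = fourierInt hbar (crossProd ψ ψ x) p := by
  set g : Conf n → ℂ := fourierInt hbar ψ with hg
  have hgi : Integrable g := integrable_fourierInt_schwartz hh ψ
  have hψ : Integrable (ψ : Conf n → ℂ) := ψ.integrable
  have hinv : ∀ y, (((1 / (2 * Real.pi * hbar) : ℝ) : ℂ)) ^ n *
      ∫ u, phase hbar (-inner ℝ u y) * g u = ψ y := fun y =>
    fourierInt_inversion_of_continuousAt hh hψ hgi ψ.continuous.continuousAt
  have hsub : ∀ y, p - (1 / 2 : ℝ) • y = p + (-1 / 2 : ℝ) • y := sub_half_eq p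
  have hgp : Integrable fun y => g (p + (-1 / 2 : ℝ) • y) := by
    rw [← memLp_one_iff_integrable] at hgi ⊢
    exact memLp_comp_affine hgi p (by norm_num)
  -- the phase of the double integral
  set θ : Conf n → Conf n → ℝ := fun y a =>
    inner ℝ (-x) y + inner ℝ (p + (1 / 2 : ℝ) • y) a with hθ
  have e1 : fourierInt hbar (crossProd g g p) (-x) = ∫ y, ∫ a,
      phase hbar (θ y a) * (starRingEnd ℂ (g (p + (-1 / 2 : ℝ) • y)) * ψ a) := by
    refine integral_congr_ae (Eventually.of_forall fun y => ?_)
    simp only [crossProd]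
    rw [hsub]
    nth_rewrite 1 [hg]
    unfold fourierInt
    rw [← integral_mul_const, ← integral_const_mul]
    refine integral_congr_ae (Eventually.of_forall fun a => ?_)
    simp only [hθ, phase_add]
    ring
  have hprod : Integrable (Function.uncurry fun y a =>
      phase hbar (θ y a) * (starRingEnd ℂ (g (p + (-1 / 2 : ℝ) • y)) * ψ a))
      (volume.prod volume) := by
    have h1 : Integrable (fun z : Conf n × Conf n =>
        starRingEnd ℂ (g (p + (-1 / 2 : ℝ) • z.1)) * ψ z.2) (volume.prod volume) :=
      Integrable.mul_prod (memLp_one_iff_integrable.1 (memLp_one_iff_integrable.2 hgp).star) hψ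
    have hc : Continuous fun z : Conf n × Conf n => phase hbar (θ z.1 z.2) :=
      (continuous_phase hbar).comp (by simp only [hθ]; fun_prop)
    exact h1.bdd_mul (c := 1) hc.aestronglyMeasurable (Eventually.of_forall fun t => by simp)
  have e2 : ∀ a, (((1 / (2 * Real.pi * hbar) : ℝ) : ℂ)) ^ n *
      ∫ y, phase hbar (θ y a) * (starRingEnd ℂ (g (p + (-1 / 2 : ℝ) • y)) * ψ a)
      = |((-1 / 2 : ℝ) ^ n)⁻¹| •
        (phase hbar (inner ℝ p ((2 : ℝ) • a - (2 : ℝ) • x)) *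
          (ψ a * starRingEnd ℂ (ψ ((2 : ℝ) • x - a)))) := fun a => by
    have h := integral_comp_affine (fun w => phase hbar (inner ℝ p ((2 : ℝ) • a - (2 : ℝ) • x)) *
      (ψ a * (phase hbar (inner ℝ w ((2 : ℝ) • x - a)) * starRingEnd ℂ (g w)))) p (-1 / 2)
    have h' : ∫ w, phase hbar (inner ℝ w ((2 : ℝ) • x - a)) * starRingEnd ℂ (g w)
        = starRingEnd ℂ (∫ w, phase hbar (-inner ℝ w ((2 : ℝ) • x - a)) * g w) := by
      rw [← integral_conj]
      refine integral_congr_ae (Eventually.of_forall fun w => ?_)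
      simp
    conv_rhs at h => rw [integral_const_mul, integral_const_mul, h']
    rw [← hinv ((2 : ℝ) • x - a)]
    have h3 : ∫ y, phase hbar (θ y a) * (starRingEnd ℂ (g (p + (-1 / 2 : ℝ) • y)) * ψ a)
        = |((-1 / 2 : ℝ) ^ n)⁻¹| • (phase hbar (inner ℝ p ((2 : ℝ) • a - (2 : ℝ) • x)) *
          (ψ a * starRingEnd ℂ (∫ w, phase hbar (-inner ℝ w ((2 : ℝ) • x - a)) * g w))) := by
      rw [← h]
      refine integral_congr_ae (Eventually.of_forall fun y => ?_)
      simp only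
      have : θ y a = inner ℝ p ((2 : ℝ) • a - (2 : ℝ) • x)
          + inner ℝ (p + (-1 / 2 : ℝ) • y) ((2 : ℝ) • x - a) := by
        simp only [hθ, inner_add_left, inner_sub_right, inner_smul_left, inner_smul_right,
          inner_neg_left, conj_trivial, real_inner_comm x y]
        ring
      rw [this, phase_add]
      ring
    rw [h3]
    simp only [Complex.real_smul, map_mul, map_pow, Complex.conj_ofReal]
    ring
  rw [e1, integral_integral_swap hprod, ← integral_const_mul]
  simp_rw [e2]
  rw [integral_smul]
  have h4 := integral_comp_affine (fun a => phase hbar (inner ℝ p ((2 : ℝ) • a - (2 : ℝ) • x)) *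
          (ψ a * starRingEnd ℂ (ψ ((2 : ℝ) • x - a)))) x (1 / 2)
  have h5 : |((-1 / 2 : ℝ) ^ n)⁻¹| = |((1 / 2 : ℝ) ^ n)⁻¹| := by
    rw [abs_inv, abs_inv, abs_pow, abs_pow]
    norm_num
  rw [h5, ← h4]
  refine integral_congr_ae (Eventually.of_forall fun y => ?_)
  have h6 : (2 : ℝ) • (x + (1 / 2 : ℝ) • y) - (2 : ℝ) • x = y := by module
  have h7 : (2 : ℝ) • x - (x + (1 / 2 : ℝ) • y) = x - (1 / 2 : ℝ) • y := by module
  simp only [h6, h7, crossProd]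

lemma norm_sq_fourier_const {hbar : ℝ} (hh : 0 < hbar) (n : ℕ) :
    ((1 / (2 * (Real.pi : ℂ) * Complex.I * (hbar : ℂ))) ^ ((n : ℂ) / 2)) *
      starRingEnd ℂ ((1 / (2 * (Real.pi : ℂ) * Complex.I * (hbar : ℂ))) ^ ((n : ℂ) / 2))
    = (((1 / (2 * Real.pi * hbar) : ℝ) : ℂ)) ^ n := by
  have hpi := Real.pi_pos
  have hne : (1 / (2 * (Real.pi : ℂ) * Complex.I * (hbar : ℂ))) ≠ 0 := by
    have : (Real.pi : ℂ) ≠ 0 := by exact_mod_cast hpi.ne'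
    have : (hbar : ℂ) ≠ 0 := by exact_mod_cast hh.ne'
    simp [*]
  have e : ((n : ℂ) / 2) = (((n : ℝ) / 2 : ℝ) : ℂ) := by push_cast; rfl
  rw [Complex.mul_conj, Complex.normSq_eq_norm_sq, e, Complex.norm_cpow_real]
  have e2 : ‖(1 / (2 * (Real.pi : ℂ) * Complex.I * (hbar : ℂ)))‖ = 1 / (2 * Real.pi * hbar) := by
    simp [abs_of_pos hpi, abs_of_pos hh]
  rw [e2, ← Complex.ofReal_pow, ← Real.rpow_natCast, ← Real.rpow_mul (by positivity),
    ← Real.rpow_natCast]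
  congr 2
  push_cast
  ring

lemma covariant_fourier {n : ℕ} {hbar : ℝ} (hh : 0 < hbar)
    {T : L2 n ≃ₗᵢ[ℂ] L2 n} (hT : IsFourier hbar T) :
    Covariant hbar T (Matrix.fromBlocks 0 1 (-1) 0) := by
  intro ψ x p
  simp only [posPart, momPart, Matrix.toBlocks_fromBlocks₁₁, Matrix.toBlocks_fromBlocks₁₂,
    Matrix.toBlocks_fromBlocks₂₁, Matrix.toBlocks_fromBlocks₂₂, act_one, act_zero, add_zero,
    zero_add, act_neg_matrix]
  have hdense : DenseRange (SchwartzMap.toLpCLM ℝ ℂ 2 (volume : Measure (Conf n))) :=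
    SchwartzMap.denseRange_toLpCLM (by norm_num)
  refine congrFun (hdense.equalizer ((continuous_wigner hbar p (-x)).comp T.continuous)
    (continuous_wigner hbar x p) (funext fun φ => ?_)) ψ
  have h1 : MemLp (φ : Conf n → ℂ) 1 volume := φ.memLp 1 volume
  have h2 : MemLp (φ : Conf n → ℂ) 2 volume := φ.memLp 2 volume
  set K : ℂ := (1 / (2 * (Real.pi : ℂ) * Complex.I * (hbar : ℂ))) ^ ((n : ℂ) / 2) with hK
  have hTφ : T (h2.toLp φ) =ᵐ[volume] fun v => K * fourierInt hbar φ v := hT φ h1 h2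
  have hφ : h2.toLp φ =ᵐ[volume] φ := h2.coeFn_toLp
  show wigner hbar (T (h2.toLp φ)) p (-x) = wigner hbar (h2.toLp φ) x p
  rw [wigner_congr hTφ, wigner_congr hφ, wigner_eq, wigner_eq,
    ← fourierInt_crossProd_fourierInt hh φ x p]
  congr 1
  rw [← norm_sq_fourier_const hh n, ← hK]
  unfold fourierInt
  rw [← integral_const_mul]
  refine integral_congr_ae (Eventually.of_forall fun y => ?_)
  simp only [crossProd, map_mul]
  ring

theorem covariant_of_mem_metaplecticGraph {n : ℕ} {hbar : ℝ} (hh : 0 < hbar)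
    {g : (L2 n ≃ₗᵢ[ℂ] L2 n) × Matrix.symplecticGroup (Fin n) ℝ}
    (hg : g ∈ metaplecticGraph n hbar) : Covariant hbar g.1 g.2.1 := by
  unfold metaplecticGraph at hg
  induction hg using Subgroup.closure_induction with
  | mem g hg =>
    obtain ⟨T, S⟩ := g
    rcases hg with ⟨P, hP, hT, hS⟩ | ⟨L, m, hm, hT, hS⟩ | ⟨hT, hS⟩
    · simp only at hT hS ⊢
      rw [hS]
      exact covariant_chirp hP hT
    · simp only at hT hS ⊢
      rw [hS]
      refine covariant_dilation ?_ hT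
      rcases hm with ⟨h, -⟩ | ⟨h, -⟩
      · exact h.ne'
      · exact h.ne
    · simp only at hT hS ⊢
      rw [hS]
      exact covariant_fourier hh hT
  | one =>
    intro ψ x p
    show wigner hbar ψ (posPart 1 x p) (momPart 1 x p) = _
    rw [posPart_one, momPart_one]
  | mul g g' _ _ h h' =>
    intro ψ x p
    show wigner hbar (g.1 (g'.1 ψ)) (posPart (g.2.1 * g'.2.1) x p)
      (momPart (g.2.1 * g'.2.1) x p) = _
    rw [posPart_mul, momPart_mul, h, h']
  | inv g _ h =>
    intro ψ x p
    have hS : g.2.1 * (g.2⁻¹).1 = 1 := congrArg Subtype.val (mul_inv_cancel g.2)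
    have h1 := h (g.1⁻¹ ψ) (posPart (g.2⁻¹).1 x p) (momPart (g.2⁻¹).1 x p)
    have hT : g.1 (g.1⁻¹ ψ) = ψ := g.1.apply_symm_apply ψ
    rw [← posPart_mul, ← momPart_mul, hS, posPart_one, momPart_one, hT] at h1
    exact h1.symm

/-! ### Wave functions with integrable Wigner transform -/

/-- The Gaussian of momentum `k`. -/
def gaussWave {n : ℕ} (hbar : ℝ) (k b : Conf n) : ℂ :=
  phase hbar (inner ℝ k b) * ((Real.exp (-1 * ‖b‖ ^ 2) : ℝ) : ℂ)

/-- The Gaussian wave of momentum `k` reflected in the phase space point `(y, p)`. -/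
def gaussAtom {n : ℕ} (hbar : ℝ) (k : Conf n) (z : Conf n × Conf n) (a : Conf n) : ℂ :=
  phase hbar (-inner ℝ z.2 (-((2 : ℝ) • z.1) + (2 : ℝ) • a)) *
    gaussWave hbar k (-a + (2 : ℝ) • z.1)

lemma continuous_gaussWave {n : ℕ} (hbar : ℝ) (k : Conf n) : Continuous (gaussWave hbar k) := by
  unfold gaussWave
  exact ((continuous_phase hbar).comp (by fun_prop)).mul (by fun_prop)

lemma continuous_gaussAtom {n : ℕ} {X : Type*} [TopologicalSpace X] (hbar : ℝ) (k : Conf n)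
    {z : X → Conf n × Conf n} {a : X → Conf n} (hz : Continuous z) (ha : Continuous a) :
    Continuous fun x => gaussAtom hbar k (z x) (a x) := by
  unfold gaussAtom
  exact ((continuous_phase hbar).comp (by fun_prop)).mul
    ((continuous_gaussWave hbar k).comp (by fun_prop))

lemma norm_gaussWave {n : ℕ} (hbar : ℝ) (k b : Conf n) :
    ‖gaussWave hbar k b‖ = Real.exp (-1 * ‖b‖ ^ 2) := by
  rw [gaussWave, norm_mul, norm_phase, one_mul, Complex.norm_real,
    Real.norm_of_nonneg (Real.exp_nonneg _)]

lemma norm_gaussAtom {n : ℕ} (hbar : ℝ) (k : Conf n) (z : Conf n × Conf n) (a : Conf n) :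
    ‖gaussAtom hbar k z a‖ = Real.exp (-1 * ‖-a + (2 : ℝ) • z.1‖ ^ 2) := by
  rw [gaussAtom, norm_mul, norm_phase, one_mul, norm_gaussWave]

lemma norm_gaussAtom_le {n : ℕ} (hbar : ℝ) (k : Conf n) (z : Conf n × Conf n) (a : Conf n) :
    ‖gaussAtom hbar k z a‖ ≤ 1 := by
  rw [norm_gaussAtom, Real.exp_le_one_iff]
  nlinarith [sq_nonneg ‖-a + (2 : ℝ) • z.1‖]

lemma integrable_exp_reflect {n : ℕ} (y : Conf n) :
    Integrable fun a : Conf n => Real.exp (-1 * ‖-a + y‖ ^ 2) := by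
  have h := (integrable_exp_neg_sq (n := n) one_pos).comp_sub_left y
  refine h.congr (Eventually.of_forall fun a => ?_)
  simp only
  rw [neg_add_eq_sub]

lemma integral_exp_reflect {n : ℕ} (y : Conf n) :
    ∫ a : Conf n, Real.exp (-1 * ‖-a + y‖ ^ 2) = ∫ a : Conf n, Real.exp (-1 * ‖a‖ ^ 2) := by
  rw [← integral_sub_left_eq_self (fun a : Conf n => Real.exp (-1 * ‖a‖ ^ 2)) volume y]
  simp only [neg_add_eq_sub]

lemma integrable_gaussAtom {n : ℕ} (hbar : ℝ) (k : Conf n) (z : Conf n × Conf n) :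
    Integrable (gaussAtom hbar k z) := by
  refine (integrable_exp_reflect ((2 : ℝ) • z.1)).mono'
    (continuous_gaussAtom hbar k continuous_const continuous_id).aestronglyMeasurable
    (Eventually.of_forall fun a => ?_)
  rw [norm_gaussAtom]

lemma norm_fourierInt_translate {n : ℕ} (hbar : ℝ) (G : Conf n → ℂ) (τ q : Conf n) :
    ‖fourierInt hbar (fun t => G (t - τ)) q‖ = ‖fourierInt hbar G q‖ := by
  have : fourierInt hbar (fun t => G (t - τ)) q
      = phase hbar (inner ℝ q τ) * fourierInt hbar G q := by
    unfold fourierInt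
    rw [← integral_const_mul, ← integral_add_right_eq_self _ τ]
    refine integral_congr_ae (Eventually.of_forall fun t => ?_)
    simp only [add_sub_cancel_right, inner_add_right, phase_add]
    ring
  rw [this, norm_mul, norm_phase, one_mul]

lemma crossProd_gaussAtom {n : ℕ} (hbar : ℝ) (k : Conf n) (z z' : Conf n × Conf n) (y : Conf n) :
    ∃ (c : ℂ) (ξ τ : Conf n), ‖c‖ ≤ 1 ∧ ∀ t,
      crossProd (gaussAtom hbar k z) (gaussAtom hbar k z') y t
      = c * (phase hbar (inner ℝ ξ t) * ((Real.exp (-(1 / 2) * ‖t - τ‖ ^ 2) : ℝ) : ℂ)) := by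
  set α : Conf n := (2 : ℝ) • z.1 - y with hα
  set β : Conf n := (2 : ℝ) • z'.1 - y with hβ
  refine ⟨phase hbar (-inner ℝ z.2 ((2 : ℝ) • y - (2 : ℝ) • z.1)
      + inner ℝ z'.2 ((2 : ℝ) • y - (2 : ℝ) • z'.1) + inner ℝ k (α - β)) *
      ((Real.exp (-(1 / 2) * ‖α + β‖ ^ 2) : ℝ) : ℂ), -z.2 - z'.2 - k, α - β, ?_, fun t => ?_⟩
  · rw [norm_mul, norm_phase, one_mul, Complex.norm_real, Real.norm_of_nonneg (Real.exp_nonneg _),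
      Real.exp_le_one_iff]
    nlinarith [sq_nonneg ‖α + β‖]
  · simp only [crossProd, gaussAtom, gaussWave, map_mul, conj_phase, Complex.conj_ofReal]
    have h1 : -(y + (1 / 2 : ℝ) • t) + (2 : ℝ) • z.1 = α - (1 / 2 : ℝ) • t := by
      rw [hα]; module
    have h2 : -(y - (1 / 2 : ℝ) • t) + (2 : ℝ) • z'.1 = β + (1 / 2 : ℝ) • t := by
      rw [hβ]; module
    have h3 : -((2 : ℝ) • z.1) + (2 : ℝ) • (y + (1 / 2 : ℝ) • t)
        = ((2 : ℝ) • y - (2 : ℝ) • z.1) + t := by module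
    have h4 : -((2 : ℝ) • z'.1) + (2 : ℝ) • (y - (1 / 2 : ℝ) • t)
        = ((2 : ℝ) • y - (2 : ℝ) • z'.1) - t := by module
    rw [h1, h2, h3, h4]
    have hexp : Real.exp (-1 * ‖α - (1 / 2 : ℝ) • t‖ ^ 2) * Real.exp (-1 * ‖β + (1 / 2 : ℝ) • t‖ ^ 2)
        = Real.exp (-(1 / 2) * ‖α + β‖ ^ 2) * Real.exp (-(1 / 2) * ‖t - (α - β)‖ ^ 2) := by
      rw [← Real.exp_add, ← Real.exp_add]
      congr 1
      simp only [← real_inner_self_eq_norm_sq, inner_add_left, inner_add_right, inner_sub_left,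
        inner_sub_right, inner_smul_left, inner_smul_right, conj_trivial, real_inner_comm α t,
        real_inner_comm β t, real_inner_comm α β]
      ring
    have hph : phase hbar (-inner ℝ z.2 (((2 : ℝ) • y - (2 : ℝ) • z.1) + t)) *
        phase hbar (inner ℝ k (α - (1 / 2 : ℝ) • t)) *
        (phase hbar (- -inner ℝ z'.2 (((2 : ℝ) • y - (2 : ℝ) • z'.1) - t)) *
        phase hbar (-inner ℝ k (β + (1 / 2 : ℝ) • t)))
        = phase hbar (-inner ℝ z.2 ((2 : ℝ) • y - (2 : ℝ) • z.1)
      + inner ℝ z'.2 ((2 : ℝ) • y - (2 : ℝ) • z'.1) + inner ℝ k (α - β)) *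
        phase hbar (inner ℝ (-z.2 - z'.2 - k) t) := by
      rw [← phase_add, ← phase_add, ← phase_add, ← phase_add]
      congr 1
      simp only [inner_add_right, inner_sub_left, inner_neg_left,
        inner_sub_right, inner_smul_right]
      ring
    have hexp' := congrArg (fun r : ℝ => (r : ℂ)) hexp
    simp only [Complex.ofReal_mul] at hexp'
    linear_combination (norm := ring_nf)
      (phase hbar (-inner ℝ z.2 (((2 : ℝ) • y - (2 : ℝ) • z.1) + t)) *
        phase hbar (inner ℝ k (α - (1 / 2 : ℝ) • t)) *
        (phase hbar (- -inner ℝ z'.2 (((2 : ℝ) • y - (2 : ℝ) • z'.1) - t)) *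
        phase hbar (-inner ℝ k (β + (1 / 2 : ℝ) • t)))) * hexp'
      + (((Real.exp (-(1 / 2) * ‖α + β‖ ^ 2) : ℝ) : ℂ) *
        ((Real.exp (-(1 / 2) * ‖t - (α - β)‖ ^ 2) : ℝ) : ℂ)) * hph

/-- The Wigner transforms of pairs of Gaussian atoms have uniformly bounded integrals over all
momentum fibres. -/
lemma exists_lintegral_gaussAtom_le {n : ℕ} {hbar : ℝ} (hh : 0 < hbar) :
    ∃ D : ℝ≥0∞, D ≠ ∞ ∧ ∀ (k : Conf n) (z z' : Conf n × Conf n) (y : Conf n),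
      ∫⁻ q, ‖fourierInt hbar (crossProd (gaussAtom hbar k z) (gaussAtom hbar k z') y) q‖ₑ
        ≤ D := by
  set Γ : Conf n → ℝ := fun q =>
    (Real.pi / (1 / 2)) ^ ((n : ℝ) / 2) * Real.exp (-‖q‖ ^ 2 / (4 * hbar ^ 2 * (1 / 2))) with hΓ
  have hΓi : Integrable Γ := by
    refine ((integrable_exp_neg_sq (n := n) (k := 1 / (4 * hbar ^ 2 * (1 / 2)))
      (by positivity)).const_mul ((Real.pi / (1 / 2)) ^ ((n : ℝ) / 2))).congr (Eventually.of_forall fun q => ?_)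
    simp only [hΓ]
    congr 2
    ring
  have hΓ0 : ∀ q, 0 ≤ Γ q := fun q => by
    have := Real.pi_pos
    positivity
  refine ⟨∫⁻ q, ENNReal.ofReal (Γ q), hΓi.lintegral_lt_top.ne, fun k z z' y => ?_⟩
  obtain ⟨c, ξ, τ, hc, h⟩ := crossProd_gaussAtom hbar k z z' y
  rw [← lintegral_add_right_eq_self (fun q => ENNReal.ofReal (Γ q)) ξ]
  refine lintegral_mono fun q => ?_
  have e : fourierInt hbar (crossProd (gaussAtom hbar k z) (gaussAtom hbar k z') y) q
      = c * fourierInt hbar (fun t => (fun s : Conf n =>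
        ((Real.exp (-(1 / 2) * ‖s‖ ^ 2) : ℝ) : ℂ)) (t - τ)) (q + ξ) := by
    unfold fourierInt
    rw [← integral_const_mul]
    refine integral_congr_ae (Eventually.of_forall fun t => ?_)
    simp only [h, inner_add_left, phase_add]
    ring
  have e2 : fourierInt hbar (fun s : Conf n => ((Real.exp (-(1 / 2) * ‖s‖ ^ 2) : ℝ) : ℂ)) (q + ξ)
      = (Γ (q + ξ) : ℂ) := by
    rw [hΓ, ← integral_exp_neg_sq_mul_phase hbar (by norm_num) (q + ξ)]
    refine integral_congr_ae (Eventually.of_forall fun t => ?_)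
    simp only
    rw [mul_comm, real_inner_comm]
  rw [← ofReal_norm]
  refine ENNReal.ofReal_le_ofReal ?_
  rw [e, norm_mul, norm_fourierInt_translate hbar
    (fun s : Conf n => ((Real.exp (-(1 / 2) * ‖s‖ ^ 2) : ℝ) : ℂ)) τ, e2, Complex.norm_real, Real.norm_of_nonneg (hΓ0 _)]
  exact mul_le_of_le_one_left (hΓ0 _) hc

lemma stronglyMeasurable_fourierInt_crossProd {n : ℕ} {X : Type*} [MeasurableSpace X] (hbar : ℝ)
    {f : X → Conf n → ℂ} {h : X → Conf n → ℂ}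
    (hf : StronglyMeasurable (Function.uncurry f)) (hh : StronglyMeasurable (Function.uncurry h))
    {y q : X → Conf n} (hy : Measurable y) (hq : Measurable q) :
    StronglyMeasurable fun x => fourierInt hbar (crossProd (f x) (h x) (y x)) (q x) := by
  unfold fourierInt crossProd
  have h1 : StronglyMeasurable fun w : X × Conf n => phase hbar (inner ℝ (q w.1) w.2) :=
    ((continuous_phase hbar).measurable.comp
      (Measurable.inner (hq.comp measurable_fst) measurable_snd)).stronglyMeasurable
  have h2 : StronglyMeasurable fun w : X × Conf n => f w.1 (y w.1 + (1 / 2 : ℝ) • w.2) :=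
    hf.comp_measurable (g := fun w : X × Conf n => (w.1, y w.1 + (1 / 2 : ℝ) • w.2))
      (measurable_fst.prodMk ((hy.comp measurable_fst).add (measurable_snd.const_smul (1 / 2 : ℝ))))
  have h3 : StronglyMeasurable fun w : X × Conf n => h w.1 (y w.1 - (1 / 2 : ℝ) • w.2) :=
    hh.comp_measurable (g := fun w : X × Conf n => (w.1, y w.1 - (1 / 2 : ℝ) • w.2))
      (measurable_fst.prodMk ((hy.comp measurable_fst).sub (measurable_snd.const_smul (1 / 2 : ℝ))))
  exact StronglyMeasurable.integral_prod_right (h1.mul (h2.mul h3.star))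

lemma enorm_fourierInt_crossProd_swap {n : ℕ} (hbar : ℝ) (f h : Conf n → ℂ) (y q : Conf n) :
    ‖fourierInt hbar (crossProd h f y) q‖ₑ = ‖fourierInt hbar (crossProd f h y) q‖ₑ := by
  have : fourierInt hbar (crossProd h f y) q
      = starRingEnd ℂ (fourierInt hbar (crossProd f h y) q) := by
    unfold fourierInt
    rw [← integral_conj, ← integral_neg_eq_self]
    refine integral_congr_ae (Eventually.of_forall fun t => ?_)
    simp only [crossProd, smul_neg, sub_neg_eq_add, ← sub_eq_add_neg, map_mul, conj_phase,
      Complex.conj_conj, inner_neg_right]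
    ring
  rw [this, ← ofReal_norm, RCLike.norm_conj, ofReal_norm]

lemma integrable_mul_gaussAtom {n : ℕ} (hbar : ℝ) (k : Conf n) {W : Conf n × Conf n → ℂ}
    (hW : Integrable W) : Integrable (fun w : (Conf n × Conf n) × Conf n =>
      W w.1 * gaussAtom hbar k w.1 w.2) (volume.prod volume) := by
  have hm : AEStronglyMeasurable (fun w : (Conf n × Conf n) × Conf n =>
      W w.1 * gaussAtom hbar k w.1 w.2) (volume.prod volume) :=
    hW.aestronglyMeasurable.comp_fst.mul (continuous_gaussAtom hbar k continuous_fst continuous_snd).aestronglyMeasurable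
  rw [integrable_prod_iff hm]
  refine ⟨Eventually.of_forall fun z => (integrable_gaussAtom hbar k z).const_mul (W z), ?_⟩
  simp only [norm_mul, norm_gaussAtom]
  simp_rw [integral_const_mul, integral_exp_reflect]
  exact hW.norm.mul_const _

lemma integrable_superposition_prod {n : ℕ} {hbar : ℝ} {k : Conf n}
    {W : Conf n × Conf n → ℂ} (hW : Integrable W)
    {h : Conf n → ℂ} (hc : Continuous h) (hi : Integrable h) (y q : Conf n) :
    Integrable (Function.uncurry fun (t : Conf n) (z : Conf n × Conf n) =>
      phase hbar (inner ℝ q t) * (W z * gaussAtom hbar k z (y + (1 / 2 : ℝ) • t) *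
        starRingEnd ℂ (h (y - (1 / 2 : ℝ) • t)))) (volume.prod volume) := by
  have hi' : Integrable fun t => h (y - (1 / 2 : ℝ) • t) := by
    simp_rw [sub_half_eq]
    rw [← memLp_one_iff_integrable] at hi ⊢
    exact memLp_comp_affine hi y (by norm_num)
  have h0 : Integrable (fun w : Conf n × (Conf n × Conf n) =>
      h (y - (1 / 2 : ℝ) • w.1) * W w.2) (volume.prod volume) := hi'.mul_prod hW
  refine h0.norm.mono' ?_ (Eventually.of_forall fun w => ?_)
  · have c1 : Continuous fun w : Conf n × (Conf n × Conf n) =>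
        phase hbar (inner ℝ q w.1) := (continuous_phase hbar).comp (by fun_prop)
    have c2 : Continuous fun w : Conf n × (Conf n × Conf n) =>
        gaussAtom hbar k w.2 (y + (1 / 2 : ℝ) • w.1) :=
      continuous_gaussAtom hbar k continuous_snd (by fun_prop)
    have c3 : Continuous fun w : Conf n × (Conf n × Conf n) =>
        starRingEnd ℂ (h (y - (1 / 2 : ℝ) • w.1)) :=
      Complex.continuous_conj.comp (hc.comp (by fun_prop))
    exact c1.aestronglyMeasurable.mul ((hW.aestronglyMeasurable.comp_snd.mul
      c2.aestronglyMeasurable).mul c3.aestronglyMeasurable)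
  · simp only [Function.uncurry, norm_mul, norm_phase, one_mul, RCLike.norm_conj]
    rw [mul_comm ‖h _‖]
    gcongr
    exact mul_le_of_le_one_right (norm_nonneg _) (norm_gaussAtom_le _ _ _ _)

lemma lintegral_fourierInt_superposition_le {n : ℕ} {hbar : ℝ} {k : Conf n}
    {W : Conf n × Conf n → ℂ} (hWm : StronglyMeasurable W) (hW : Integrable W)
    {h : Conf n → ℂ} (hc : Continuous h) (hi : Integrable h) (M : ℂ) {D : ℝ≥0∞} (y : Conf n)
    (hD : ∀ z, ∫⁻ q, ‖fourierInt hbar (crossProd (gaussAtom hbar k z) h y) q‖ₑ ≤ D) :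
    ∫⁻ q, ‖fourierInt hbar (crossProd (fun a => M * ∫ z, W z * gaussAtom hbar k z a) h y) q‖ₑ
      ≤ ‖M‖ₑ * ((∫⁻ z, ‖W z‖ₑ) * D) := by
  have e : ∀ q, fourierInt hbar
      (crossProd (fun a => M * ∫ z, W z * gaussAtom hbar k z a) h y) q
      = M * ∫ z, W z * fourierInt hbar (crossProd (gaussAtom hbar k z) h y) q := fun q => by
    have hprod := integrable_superposition_prod (hbar := hbar) (k := k) hW hc hi y q
    have e1 : fourierInt hbar
        (crossProd (fun a => M * ∫ z, W z * gaussAtom hbar k z a) h y) q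
        = M * ∫ t, ∫ z, phase hbar (inner ℝ q t) * (W z * gaussAtom hbar k z
          (y + (1 / 2 : ℝ) • t) * starRingEnd ℂ (h (y - (1 / 2 : ℝ) • t))) := by
      unfold fourierInt
      rw [← integral_const_mul]
      refine integral_congr_ae (Eventually.of_forall fun t => ?_)
      simp only [crossProd]
      rw [integral_const_mul, integral_mul_const]
      ring
    rw [e1, integral_integral_swap hprod]
    congr 1
    refine integral_congr_ae (Eventually.of_forall fun z => ?_)
    unfold fourierInt
    simp only
    rw [← integral_const_mul]
    refine integral_congr_ae (Eventually.of_forall fun t => ?_)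
    simp only [crossProd]
    ring
  have hm : Measurable (Function.uncurry fun (q : Conf n) (z : Conf n × Conf n) =>
      ‖W z * fourierInt hbar (crossProd (gaussAtom hbar k z) h y) q‖ₑ) := by
    have s1 := stronglyMeasurable_fourierInt_crossProd (X := Conf n × (Conf n × Conf n)) hbar
      (f := fun x => gaussAtom hbar k x.2) (h := fun _ => h)
      (continuous_gaussAtom hbar k (by fun_prop) (by fun_prop)).stronglyMeasurable
      ((hc.comp continuous_snd).stronglyMeasurable) (y := fun _ => y) (q := fun x => x.1)
      measurable_const measurable_fst
    exact ((hWm.comp_measurable measurable_snd).mul s1).enorm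
  calc ∫⁻ q, ‖fourierInt hbar
        (crossProd (fun a => M * ∫ z, W z * gaussAtom hbar k z a) h y) q‖ₑ
      ≤ ∫⁻ q, ‖M‖ₑ * ∫⁻ z, ‖W z * fourierInt hbar (crossProd (gaussAtom hbar k z) h y) q‖ₑ := by
        refine lintegral_mono fun q => ?_
        rw [e, enorm_mul]
        gcongr
        exact enorm_integral_le_lintegral_enorm _
    _ = ‖M‖ₑ * ∫⁻ z, ∫⁻ q, ‖W z * fourierInt hbar (crossProd (gaussAtom hbar k z) h y) q‖ₑ := by
        rw [lintegral_const_mul' _ _ enorm_ne_top, lintegral_lintegral_swap hm.aemeasurable]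
    _ ≤ ‖M‖ₑ * ∫⁻ z, ‖W z‖ₑ * D := by
        gcongr with z
        simp only [enorm_mul]
        rw [lintegral_const_mul' _ _ enorm_ne_top]
        gcongr
        exact hD z
    _ = ‖M‖ₑ * ((∫⁻ z, ‖W z‖ₑ) * D) := by
        rw [lintegral_mul_const _ hWm.enorm]

/-- A nonzero wave function has a nonzero overlap with a Gaussian of some momentum. -/
lemma exists_gaussWave_overlap_ne_zero {n : ℕ} {hbar : ℝ} (hh : 0 < hbar) {f : Conf n → ℂ}
    (hf : MemLp f 2 volume) (h0 : ¬ f =ᵐ[volume] 0) :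
    ∃ k : Conf n, ∫ b, starRingEnd ℂ (f b) * gaussWave hbar k b ≠ 0 := by
  by_contra! hcon
  apply h0
  set F : Conf n → ℂ := fun b => starRingEnd ℂ (f b) * ((Real.exp (-1 * ‖b‖ ^ 2) : ℝ) : ℂ) with hF
  have hg : MemLp (fun b : Conf n => ((Real.exp (-1 * ‖b‖ ^ 2) : ℝ) : ℂ)) 2 volume := by
    have hc : Continuous fun b : Conf n => ((Real.exp (-1 * ‖b‖ ^ 2) : ℝ) : ℂ) := by fun_prop
    rw [memLp_two_iff_integrable_sq_norm hc.aestronglyMeasurable]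
    refine (integrable_exp_neg_sq (n := n) two_pos).congr (Eventually.of_forall fun b => ?_)
    simp only
    rw [Complex.norm_real, Real.norm_of_nonneg (Real.exp_nonneg _), ← Real.exp_nat_mul]
    congr 1
    push_cast
    ring
  have hFi : Integrable F := hf.star.integrable_mul hg
  have hz : fourierInt hbar F = 0 := by
    ext k
    rw [Pi.zero_apply, ← hcon k]
    refine integral_congr_ae (Eventually.of_forall fun b => ?_)
    simp only [hF, gaussWave]
    ring
  have hinv := ae_fourierInt_inversion hh hFi (by rw [hz]; exact integrable_zero _ _ _)
  filter_upwards [hinv] with b hb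
  simp only [hz, Pi.zero_apply, mul_zero, integral_zero] at hb
  have hexp : ((Real.exp (-1 * ‖b‖ ^ 2) : ℝ) : ℂ) ≠ 0 :=
    Complex.ofReal_ne_zero.2 (Real.exp_pos _).ne'
  have := (mul_eq_zero.1 hb.symm).resolve_right hexp
  simpa using this

/-- A wave function with integrable Wigner transform is a superposition of Gaussian atoms. -/
lemma ae_eq_superposition {n : ℕ} {hbar : ℝ} (hh : 0 < hbar) {f : Conf n → ℂ}
    (hfm : StronglyMeasurable f) (hf : MemLp f 2 volume)
    {W : Conf n × Conf n → ℂ} (hWdef : W = fun z => fourierInt hbar (crossProd f f z.1) z.2)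
    (hWm : StronglyMeasurable W) (hW : Integrable W)
    {k : Conf n} (hk : ∫ b, starRingEnd ℂ (f b) * gaussWave hbar k b ≠ 0) :
    ∃ M : ℂ, f =ᵐ[volume] fun a => M * ∫ z, W z * gaussAtom hbar k z a := by
  set κ := ∫ b, starRingEnd ℂ (f b) * gaussWave hbar k b with hκ
  set C : ℂ := (((1 / (2 * Real.pi * hbar) : ℝ) : ℂ)) ^ n with hC
  set d : ℝ := |((2 : ℝ) ^ n)⁻¹| with hd
  have hd0 : (d : ℂ) ≠ 0 := by
    rw [hd]; exact Complex.ofReal_ne_zero.2 (by positivity)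
  have h1 : ∀ᵐ y : Conf n, ∀ᵐ a : Conf n, f a * starRingEnd ℂ (f (-a + (2 : ℝ) • y))
      = C * ∫ p, phase hbar (-inner ℝ p (-((2 : ℝ) • y) + (2 : ℝ) • a)) * W (y, p) := by
    have hWr : Integrable W (volume.prod volume) := hW
    filter_upwards [hWr.prod_right_ae] with y hy
    have hi : Integrable (fourierInt hbar (crossProd f f y)) := by
      simpa only [hWdef] using hy
    have h2 := ae_fourierInt_inversion hh (integrable_crossProd hf hf y) hi
    have h3 := (quasiMeasurePreserving_affine (-((2 : ℝ) • y)) (a := 2) two_ne_zero).ae h2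
    filter_upwards [h3] with a ha
    have e1 : y + (1 / 2 : ℝ) • (-((2 : ℝ) • y) + (2 : ℝ) • a) = a := by module
    have e2 : y - (1 / 2 : ℝ) • (-((2 : ℝ) • y) + (2 : ℝ) • a) = -a + (2 : ℝ) • y := by module
    conv at ha => rhs; rw [crossProd, e1, e2]
    rw [← ha, hWdef]
  have hmeas : MeasurableSet {x : Conf n × Conf n |
      f x.2 * starRingEnd ℂ (f (-x.2 + (2 : ℝ) • x.1))
      = C * ∫ p, phase hbar (-inner ℝ p (-((2 : ℝ) • x.1) + (2 : ℝ) • x.2)) * W (x.1, p) } := by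
    refine measurableSet_eq_fun ?_ ?_
    · have m1 : Measurable fun x : Conf n × Conf n => f (-x.2 + (2 : ℝ) • x.1) :=
        hfm.measurable.comp (by fun_prop)
      exact (hfm.measurable.comp measurable_snd).mul
        (Complex.continuous_conj.measurable.comp m1)
    · have m2 : StronglyMeasurable fun w : (Conf n × Conf n) × Conf n =>
          phase hbar (-inner ℝ w.2 (-((2 : ℝ) • w.1.1) + (2 : ℝ) • w.1.2)) * W (w.1.1, w.2) := by
        refine (((continuous_phase hbar).comp (by fun_prop)).stronglyMeasurable).mul
          (hWm.comp_measurable (by fun_prop))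
      exact (measurable_const.mul (StronglyMeasurable.integral_prod_right m2).measurable)
  have h2 := (Measure.ae_ae_comm (μ := (volume : Measure (Conf n)))
    (ν := (volume : Measure (Conf n))) hmeas).1 h1
  refine ⟨C * (κ * d)⁻¹, ?_⟩
  filter_upwards [h2] with a ha
  have hprod : Integrable (fun z : Conf n × Conf n => W z * gaussAtom hbar k z a)
      (volume.prod volume) := by
    have hWr : Integrable W (volume.prod volume) := hW
    refine hWr.mul_bdd (c := 1)
      (continuous_gaussAtom hbar k continuous_id continuous_const).aestronglyMeasurable
      (Eventually.of_forall fun z => norm_gaussAtom_le _ _ _ _)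
  have e1 : f a * (d * κ) = ∫ y, (f a * starRingEnd ℂ (f (-a + (2 : ℝ) • y))) *
      gaussWave hbar k (-a + (2 : ℝ) • y) := by
    have := integral_comp_affine (fun b => starRingEnd ℂ (f b) * gaussWave hbar k b) (-a) 2
    rw [Complex.real_smul] at this
    rw [← this, ← integral_const_mul]
    simp only [mul_assoc]
  have e2 : f a * (d * κ) = C * ∫ z, W z * gaussAtom hbar k z a := by
    rw [e1, Measure.volume_eq_prod, integral_prod _ hprod, ← integral_const_mul]
    refine integral_congr_ae ?_
    filter_upwards [ha] with y hy
    rw [hy, mul_assoc, ← integral_mul_const]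
    congr 2
    ext p
    simp only [gaussAtom]
    ring
  rw [mul_right_comm, ← e2]
  field_simp

lemma continuous_superposition {n : ℕ} (hbar : ℝ) (k : Conf n) {W : Conf n × Conf n → ℂ}
    (hW : Integrable W) (M : ℂ) :
    Continuous fun a => M * ∫ z, W z * gaussAtom hbar k z a := by
  refine continuous_const.mul (continuous_of_dominated (bound := fun z => ‖W z‖) (fun a => ?_)
    (fun a => Eventually.of_forall fun z => ?_) hW.norm (Eventually.of_forall fun z => ?_))
  · exact hW.aestronglyMeasurable.mul
      (continuous_gaussAtom hbar k continuous_id continuous_const).aestronglyMeasurable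
  · rw [norm_mul]
    exact mul_le_of_le_one_right (norm_nonneg _) (norm_gaussAtom_le _ _ _ _)
  · exact continuous_const.mul (continuous_gaussAtom hbar k continuous_const continuous_id)

/-- A wave function with integrable Wigner transform has a continuous representative, and its
Wigner transform is integrable over every momentum fibre. -/
theorem exists_continuous_rep_of_integrable_wigner {n : ℕ} {hbar : ℝ} (hh : 0 < hbar) (φ : L2 n)
    (hW : Integrable fun z : Conf n × Conf n => wigner hbar φ z.1 z.2) :
    ∃ f : Conf n → ℂ, Continuous f ∧ f =ᵐ[volume] φ ∧
      ∀ y q : Conf n, Integrable fun u => wigner hbar f y (u + q) := by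
  by_cases h0 : φ =ᵐ[volume] (0 : Conf n → ℂ)
  · refine ⟨0, continuous_zero, h0.symm, fun y q => ?_⟩
    have : ∀ u, wigner hbar (0 : Conf n → ℂ) y (u + q) = 0 := fun u => by
      simp [wigner]
    simp_rw [this]
    exact integrable_zero _ _ _
  have hφm : StronglyMeasurable φ := Lp.stronglyMeasurable φ
  have hφ : MemLp φ 2 volume := Lp.memLp φ
  set C : ℂ := (((1 / (2 * Real.pi * hbar) : ℝ) : ℂ)) ^ n with hC
  have hC0 : C ≠ 0 := by
    have := Real.pi_pos
    exact pow_ne_zero _ (Complex.ofReal_ne_zero.2 (by positivity))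
  set W : Conf n × Conf n → ℂ := fun z => fourierInt hbar (crossProd φ φ z.1) z.2 with hWdef
  have hWm : StronglyMeasurable W :=
    stronglyMeasurable_fourierInt_crossProd hbar (f := fun _ => φ) (h := fun _ => φ)
      (hφm.comp_measurable measurable_snd) (hφm.comp_measurable measurable_snd)
      measurable_fst measurable_snd
  have hWi : Integrable W := by
    refine (hW.const_mul C⁻¹).congr (Eventually.of_forall fun z => ?_)
    simp only [wigner_eq, hWdef]
    rw [← mul_assoc, inv_mul_cancel₀ hC0, one_mul]
  obtain ⟨k, hk⟩ := exists_gaussWave_overlap_ne_zero hh hφ h0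
  obtain ⟨M, hM⟩ := ae_eq_superposition hh hφm hφ hWdef hWm hWi hk
  set f : Conf n → ℂ := fun a => M * ∫ z, W z * gaussAtom hbar k z a with hf
  have hfc : Continuous f := continuous_superposition hbar k hWi M
  have hf1 : Integrable f := by
    have := (integrable_mul_gaussAtom hbar k hWi).integral_prod_right
    exact this.const_mul M
  have hf2 : MemLp f 2 volume := hφ.ae_eq hM
  refine ⟨f, hfc, hM.symm, fun y q => ?_⟩
  obtain ⟨D, hD, hatoms⟩ := exists_lintegral_gaussAtom_le (n := n) hh
  have hb1 : ∀ z, ∫⁻ u, ‖fourierInt hbar (crossProd (gaussAtom hbar k z) f y) u‖ₑ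
      ≤ ‖M‖ₑ * ((∫⁻ z, ‖W z‖ₑ) * D) := fun z => by
    simp_rw [enorm_fourierInt_crossProd_swap hbar f (gaussAtom hbar k z) y]
    exact lintegral_fourierInt_superposition_le hWm hWi
      (continuous_gaussAtom hbar k continuous_const continuous_id) (integrable_gaussAtom hbar k z)
      M y fun z' => hatoms k z' z y
  have hb2 : ∫⁻ u, ‖fourierInt hbar (crossProd f f y) u‖ₑ
      ≤ ‖M‖ₑ * ((∫⁻ z, ‖W z‖ₑ) * (‖M‖ₑ * ((∫⁻ z, ‖W z‖ₑ) * D))) :=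
    lintegral_fourierInt_superposition_le hWm hWi hfc hf1 M y hb1
  have hWfin : ∫⁻ z, ‖W z‖ₑ ≠ ∞ := hWi.2.ne
  have hint : Integrable (fourierInt hbar (crossProd f f y)) := by
    refine ⟨(continuous_fourierInt (integrable_crossProd hf2 hf2 y)).aestronglyMeasurable, ?_⟩
    refine lt_of_le_of_lt hb2 ?_
    finiteness
  simp_rw [wigner_eq]
  exact (hint.comp_add_right q).const_mul _

/-! ### Lagrangian planes -/

lemma orthogonal_relations {n : ℕ} {A B : Matrix (Fin n) (Fin n) ℝ}
    (hs : (A.transpose * B).IsSymm) (hn : A.transpose * A + B.transpose * B = 1) :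
    A * B.transpose = B * A.transpose ∧ A * A.transpose + B * B.transpose = 1 := by
  have hs' : B.transpose * A = A.transpose * B := by
    have := hs.eq
    rwa [Matrix.transpose_mul, Matrix.transpose_transpose] at this
  have h1 : Matrix.fromBlocks A.transpose (-B.transpose) B.transpose A.transpose *
      Matrix.fromBlocks A B (-B) A = 1 := by
    rw [Matrix.fromBlocks_multiply, ← Matrix.fromBlocks_one]
    congr 1
    · rw [Matrix.neg_mul, Matrix.mul_neg, neg_neg, hn]
    · rw [Matrix.neg_mul, hs', add_neg_cancel]
    · rw [Matrix.mul_neg, hs', add_neg_cancel]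
    · rw [add_comm, hn]
  have h2 := mul_eq_one_comm.1 h1
  rw [Matrix.fromBlocks_multiply, ← Matrix.fromBlocks_one, Matrix.fromBlocks_inj] at h2
  obtain ⟨h11, h12, -, -⟩ := h2
  refine ⟨?_, h11⟩
  rw [Matrix.mul_neg, neg_add_eq_zero] at h12
  exact h12

lemma onPlane_wigner_eq {n : ℕ} {hbar : ℝ} {A B : Matrix (Fin n) (Fin n) ℝ}
    (hs : (A.transpose * B).IsSymm) (hn : A.transpose * A + B.transpose * B = 1)
    {T : L2 n → L2 n} (hT : Covariant hbar T (Matrix.fromBlocks A B (-B) A)) (ψ : L2 n)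
    (x p u : Conf n) : onPlane A B (wigner hbar ψ) x p u
      = wigner hbar (T ψ) (act A x + act B p) (u + (act A p - act B x)) := by
  obtain ⟨h1, h2⟩ := orthogonal_relations hs hn
  unfold onPlane
  rw [← hT]
  simp only [posPart, momPart, Matrix.toBlocks_fromBlocks₁₁, Matrix.toBlocks_fromBlocks₁₂,
    Matrix.toBlocks_fromBlocks₂₁, Matrix.toBlocks_fromBlocks₂₂, act_add, act_neg, act_neg_matrix]
  simp only [← act_mul, h1]
  congr 1
  · abel
  · have : u = act (A * A.transpose) u + act (B * B.transpose) u := by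
      rw [← act_add_matrix, h2, act_one]
    nth_rewrite 3 [this]
    abel

lemma integrable_wigner_of_covariant {n : ℕ} {hbar : ℝ} {A B : Matrix (Fin n) (Fin n) ℝ}
    (hs : (A.transpose * B).IsSymm) (hn : A.transpose * A + B.transpose * B = 1)
    {T : L2 n → L2 n} (hT : Covariant hbar T (Matrix.fromBlocks A B (-B) A)) (ψ : L2 n)
    (hW : Integrable fun z : Conf n × Conf n => wigner hbar ψ z.1 z.2) :
    Integrable fun z : Conf n × Conf n => wigner hbar (T ψ) z.1 z.2 := by
  obtain ⟨h1, h2⟩ := orthogonal_relations hs hn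
  have hs' : B.transpose * A = A.transpose * B := by
    have := hs.eq
    rwa [Matrix.transpose_mul, Matrix.transpose_transpose] at this
  -- the inverse rotation of phase space
  let V : (Conf n × Conf n) →ₗ[ℝ] (Conf n × Conf n) :=
    { toFun := fun z => (act A.transpose z.1 - act B.transpose z.2,
        act B.transpose z.1 + act A.transpose z.2)
      map_add' := fun z w => by
        ext1 <;> simp only [Prod.fst_add, Prod.snd_add, act_add] <;> abel
      map_smul' := fun c z => by
        ext1 <;> simp only [Prod.smul_fst, Prod.smul_snd, act_smul, RingHom.id_apply,
          smul_sub, smul_add] }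
  have hUV : ∀ z : Conf n × Conf n,
      act A (V z).1 + act B (V z).2 = z.1 ∧ -act B (V z).1 + act A (V z).2 = z.2 := fun z => by
    simp only [V, LinearMap.coe_mk, AddHom.coe_mk, act_add, act_sub, ← act_mul, h1]
    constructor
    · calc _ = act (A * A.transpose + B * B.transpose) z.1 := by rw [act_add_matrix]; abel
        _ = z.1 := by rw [h2, act_one]
    · calc _ = act (A * A.transpose + B * B.transpose) z.2 := by rw [act_add_matrix]; abel
        _ = z.2 := by rw [h2, act_one]
  have hinj : Function.Injective V := fun z w hzw => by
    ext1
    · rw [← (hUV z).1, ← (hUV w).1, hzw]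
    · rw [← (hUV z).2, ← (hUV w).2, hzw]
  have hdet : LinearMap.det V ≠ 0 :=
    ((LinearEquiv.ofInjectiveEndo V hinj).isUnit_det').ne_zero
  have hemb : MeasurableEmbedding V :=
    (LinearEquiv.ofInjectiveEndo V hinj).toContinuousLinearEquiv.toHomeomorph.measurableEmbedding
  have : (volume : Measure (Conf n × Conf n)).IsAddHaarMeasure :=
    inferInstanceAs ((volume : Measure (Conf n)).prod volume).IsAddHaarMeasure
  have hmap := Measure.map_linearMap_addHaar_eq_smul_addHaar
    (volume : Measure (Conf n × Conf n)) hdet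
  have hW' := hW.smul_measure (c := ENNReal.ofReal |(LinearMap.det V)⁻¹|) ENNReal.ofReal_ne_top
  rw [← hmap, hemb.integrable_map_iff] at hW'
  refine hW'.congr (Eventually.of_forall fun z => ?_)
  simp only [Function.comp_apply]
  rw [← hT ψ (V z).1 (V z).2]
  simp only [posPart, momPart, Matrix.toBlocks_fromBlocks₁₁, Matrix.toBlocks_fromBlocks₁₂,
    Matrix.toBlocks_fromBlocks₂₁, Matrix.toBlocks_fromBlocks₂₂, act_neg_matrix, (hUV z).1,
    (hUV z).2]

lemma onPlane_wigner_eq_of_ae_eq {n : ℕ} {hbar : ℝ} {A B : Matrix (Fin n) (Fin n) ℝ}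
    (hs : (A.transpose * B).IsSymm) (hn : A.transpose * A + B.transpose * B = 1)
    {T : L2 n → L2 n} (hT : Covariant hbar T (Matrix.fromBlocks A B (-B) A)) {ψ : Conf n → ℂ}
    (h2 : MemLp ψ 2 volume) {f : Conf n → ℂ} (hf : f =ᵐ[volume] T (h2.toLp ψ))
    (x p : Conf n) : onPlane A B (wigner hbar ψ) x p
      = fun u => wigner hbar f (act A x + act B p) (u + (act A p - act B x)) := by
  have hψ : wigner hbar (h2.toLp ψ) = wigner hbar ψ :=
    funext fun x => funext fun p => wigner_congr h2.coeFn_toLp x p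
  ext u
  rw [← hψ, onPlane_wigner_eq hs hn hT, wigner_congr hf]

/-- The plane integrals of a Wigner transform at a Lebesgue point. -/
theorem planeIntegral_wigner_of_meanVanishesAt {n : ℕ} {hbar : ℝ} (hh : 0 < hbar)
    {A B : Matrix (Fin n) (Fin n) ℝ}
    (hs : (A.transpose * B).IsSymm) (hn : A.transpose * A + B.transpose * B = 1)
    {T : L2 n → L2 n} (hT : Covariant hbar T (Matrix.fromBlocks A B (-B) A)) {ψ : Conf n → ℂ}
    (h2 : MemLp ψ 2 volume) {f : Conf n → ℂ} (hf : f =ᵐ[volume] T (h2.toLp ψ))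
    {x p y : Conf n} (hy : act A x + act B p = y)
    (hv : MeanVanishesAt (fun t => ENNReal.ofReal (‖f t - f y‖ + ‖f t - f y‖ ^ 2)) y) :
    (PlaneIntegrable A B (wigner hbar ψ) x p →
      planeIntegral A B (wigner hbar ψ) x p = ((‖f y‖ ^ 2 : ℝ) : ℂ)) ∧
    Tendsto (fun ε : ℝ => regPlaneIntegral A B (wigner hbar ψ) x p ε) (𝓝[>] 0)
      (𝓝 ((‖f y‖ ^ 2 : ℝ) : ℂ)) := by
  have hf2 : MemLp f 2 volume := (Lp.memLp (T (h2.toLp ψ))).ae_eq hf.symm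
  unfold PlaneIntegrable planeIntegral regPlaneIntegral
  rw [onPlane_wigner_eq_of_ae_eq hs hn hT h2 hf x p, hy]
  exact ⟨integral_wigner_eq hh hf2 hv _, tendsto_gauss_wigner hh hf2 hv _⟩

/-- The plane integrals of an integrable Wigner transform. -/
theorem planeIntegral_wigner_of_integrable {n : ℕ} {hbar : ℝ} (hh : 0 < hbar)
    {A B : Matrix (Fin n) (Fin n) ℝ}
    (hs : (A.transpose * B).IsSymm) (hn : A.transpose * A + B.transpose * B = 1)
    {T : L2 n → L2 n} (hT : Covariant hbar T (Matrix.fromBlocks A B (-B) A)) {ψ : Conf n → ℂ}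
    (h2 : MemLp ψ 2 volume)
    (hW : Integrable (fun z : Conf n × Conf n => wigner hbar ψ z.1 z.2) volume) :
    ∃ f : Conf n → ℂ, Continuous f ∧ f =ᵐ[volume] T (h2.toLp ψ) ∧
      ∀ x p : Conf n, PlaneIntegrable A B (wigner hbar ψ) x p ∧
        planeIntegral A B (wigner hbar ψ) x p
          = ((‖f (act A x + act B p)‖ ^ 2 : ℝ) : ℂ) := by
  have hW' : Integrable fun z : Conf n × Conf n => wigner hbar (h2.toLp ψ) z.1 z.2 :=
    hW.congr (Eventually.of_forall fun z => (wigner_congr h2.coeFn_toLp z.1 z.2).symm)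
  obtain ⟨f, hfc, hf, hi⟩ := exists_continuous_rep_of_integrable_wigner hh _
    (integrable_wigner_of_covariant hs hn hT _ hW')
  refine ⟨f, hfc, hf, fun x p => ?_⟩
  have hP : PlaneIntegrable A B (wigner hbar ψ) x p := by
    unfold PlaneIntegrable
    rw [onPlane_wigner_eq_of_ae_eq hs hn hT h2 hf x p]
    exact hi _ _
  exact ⟨hP, (planeIntegral_wigner_of_meanVanishesAt hh hs hn hT h2 hf rfl
    (meanVanishesAt_of_continuousAt hfc.continuousAt)).1 hP⟩

end WignerRadon

end

theorem mainTheorem8 (n : ℕ) (hbar : ℝ) (hhbar : 0 < hbar)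
    (l : Submodule ℝ (WignerRadon.Conf n × WignerRadon.Conf n))
    (hl : WignerRadon.IsLagrangian l)
    (A B : Matrix (Fin n) (Fin n) ℝ) (hAB : WignerRadon.RepresentedBy l A B)
    (ψ : WignerRadon.Conf n → ℂ) (h1 : MemLp ψ 1 volume) (h2 : MemLp ψ 2 volume)
    (Uhat : WignerRadon.metaplecticGroup n hbar)
    (hU : WignerRadon.Covers hbar Uhat (Matrix.fromBlocks A B (-B) A)) :
    -- almost everywhere, for any representative `f` of the class of `Uhat ψ`
    (∀ f : WignerRadon.Conf n → ℂ,
      f =ᵐ[volume] (Uhat : WignerRadon.L2 n ≃ₗᵢ[ℂ] WignerRadon.L2 n) (h2.toLp ψ) →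
      ∀ᵐ y : WignerRadon.Conf n, ∀ x p : WignerRadon.Conf n,
        WignerRadon.act A x + WignerRadon.act B p = y →
        (WignerRadon.PlaneIntegrable A B (WignerRadon.wigner hbar ψ) x p →
          WignerRadon.planeIntegral A B (WignerRadon.wigner hbar ψ) x p
            = ((‖f y‖ ^ 2 : ℝ) : ℂ)) ∧
        Tendsto (fun ε : ℝ =>
            WignerRadon.regPlaneIntegral A B (WignerRadon.wigner hbar ψ) x p ε)
          (𝓝[>] 0) (𝓝 ((‖f y‖ ^ 2 : ℝ) : ℂ))) ∧
    -- at every point of continuity of a representative `f`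
    (∀ f : WignerRadon.Conf n → ℂ,
      f =ᵐ[volume] (Uhat : WignerRadon.L2 n ≃ₗᵢ[ℂ] WignerRadon.L2 n) (h2.toLp ψ) →
      ∀ x p : WignerRadon.Conf n,
        ContinuousAt f (WignerRadon.act A x + WignerRadon.act B p) →
        (WignerRadon.PlaneIntegrable A B (WignerRadon.wigner hbar ψ) x p →
          WignerRadon.planeIntegral A B (WignerRadon.wigner hbar ψ) x p
            = ((‖f (WignerRadon.act A x + WignerRadon.act B p)‖ ^ 2 : ℝ) : ℂ)) ∧
        Tendsto (fun ε : ℝ =>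
            WignerRadon.regPlaneIntegral A B (WignerRadon.wigner hbar ψ) x p ε)
          (𝓝[>] 0)
          (𝓝 ((‖f (WignerRadon.act A x + WignerRadon.act B p)‖ ^ 2 : ℝ) : ℂ))) ∧
    -- everywhere, if the Wigner transform is integrable on phase space
    (Integrable (fun z : WignerRadon.Conf n × WignerRadon.Conf n =>
        WignerRadon.wigner hbar ψ z.1 z.2) volume →
      ∃ f : WignerRadon.Conf n → ℂ, Continuous f ∧
        f =ᵐ[volume] (Uhat : WignerRadon.L2 n ≃ₗᵢ[ℂ] WignerRadon.L2 n) (h2.toLp ψ) ∧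
        ∀ x p : WignerRadon.Conf n,
          WignerRadon.PlaneIntegrable A B (WignerRadon.wigner hbar ψ) x p ∧
          WignerRadon.planeIntegral A B (WignerRadon.wigner hbar ψ) x p
            = ((‖f (WignerRadon.act A x + WignerRadon.act B p)‖ ^ 2 : ℝ) : ℂ)) := by
  obtain ⟨hS, hmem⟩ := hU
  have hcov := WignerRadon.covariant_of_mem_metaplecticGraph hhbar hmem
  refine ⟨fun f hf => ?_, fun f hf x p hc => ?_, fun hW => ?_⟩
  · filter_upwards [WignerRadon.ae_meanVanishesAt ((Lp.memLp _).ae_eq hf.symm)] with y hy x p hxp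
    exact WignerRadon.planeIntegral_wigner_of_meanVanishesAt hhbar hAB.symm hAB.normalized hcov
      h2 hf hxp hy
  · exact WignerRadon.planeIntegral_wigner_of_meanVanishesAt hhbar hAB.symm hAB.normalized hcov
      h2 hf rfl (WignerRadon.meanVanishesAt_of_continuousAt hc)
  · exact WignerRadon.planeIntegral_wigner_of_integrable hhbar hAB.symm hAB.normalized hcov h2 hW
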